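/- A permutation $\pi$ of $\{1,\dots,n\}$ is an involution if $\pi=\pi^{-1}$; $\mathcal I_n$ is the set of these. Let $I_r(x)=\sum_{n\ge 0} I^r_{3412}(n)x^n$ (a formal power series over $\mathbb Q$), where $I^r_{3412}(n)$ is the number of $\pi\in\mathcal I_n$ with exactly $r$ occurrences of the pattern $3412$. **Kernels.** For $\pi\in\mathcal I_n$, $n\ge1$, let $G_\pi$ be the bipartite graph whose vertices are the entries of $\pi$ and the occurrences of $3412$ in $\pi$, an entry being joined to each occurrence it belongs to. The *kernel* $\ker\pi$ consists of the entries in the connected component of $G_\pi$ containing the entry $1$, together with the first entry $\pi(1)$ (which lies in this component already unless the entry $1$ belongs to no occurrence). If $\ker \pi=\pi(i_1),\dots,\pi(i_s)$ with $i_1<\dots<i_s$, the permutation $\rho$ of $\{1,\dots,s\}$ order-isomorphic to it is the *kernel shape* of $\pi$. Let $K_t$ be the set of the kernel shapes (of all sizes) of the elements of $\mathcal I_t$, and $\mathcal I(\rho)$ the set of the involutions of all lengths with kernel shape $\rho$. For a kernel shape $\rho$, let $s(\rho)$ be its size and $c(\rho)$ its number of occurrences of $3412$ (its capacity). **Cells.**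 Suppose that an involution $\pi$ of length $n$ has at the positions $i_1<\dots<i_s$ entries order-isomorphic to $\rho$. For $1\le m,\ell\le s$ the cell $C_{m\ell}$ is the set of the entries $\pi(j)$ with $i_\ell<j<i_{\ell+1}$ that lie strictly between the $m$-th and the $(m+1)$-st smallest of $\pi(i_1),\dots,\pi(i_s)$, where $i_{s+1}=n+1$ and the $(s+1)$-st smallest entry is read as $n+1$. The cell $C_{m\ell}$ of $\rho$ is *infeasible* if, for every involution $\pi$ and all such positions with $\{i_1,\dots,i_s\}$ mapped to itself by $\pi$, each entry $a\in C_{m\ell}$ belongs to an occurrence of $3412$ in $\pi$ that contains at least two of the entries $\pi(i_1),\dots,\pi(i_s)$; otherwise it is *feasible*. Call a feasible cell *forced* if, for every $\pi\in\mathcal I(\rho)$ and with $\pi(i_1),\dots,\pi(i_s)$ the kernel of $\pi$, the entries of the cell decrease from left to right. Let $f(\rho)$ be the number of feasible cells that are not forced (free cells), $dd(\rho)$ the number of forced feasible cells $C_{mm}$ (diagonal-decreasing cells), and $d(\rho)$ the number of forced feasible cells $C_{m\ell}$ with $m>\ell$ (decreasing cells above the diagonal). **Theorem.** For every $r\ge1$,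 $$I_r(x)=\sum_{\rho\in K_{2r+2}}\frac{x^{s(\rho)}}{(1-x^2)^{d(\rho)}(1-x)^{dd(\rho)}}\sum_{r_1+\dots+r_{f(\rho)}=r-c(\rho)}\ \prod_{j=1}^{f(\rho)}I_{r_j}(x),$$ where the inner sum runs over integers $r_1,\dots,r_{f(\rho)}\ge0$ (and is empty if $c(\rho)>r$). -/

import Mathlib

namespace InvKernel

/-- Entries and indices are numbered from `0`: a permutation of `n` letters is a
`π : Equiv.Perm (Fin n)`, and the entry of `π` at position `i` is `π i`.
It is an involution if it equals its own inverse. -/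
def IsInvolution {n : ℕ} (π : Equiv.Perm (Fin n)) : Prop := π⁻¹ = π

/-- The pattern `3412`. -/
def p3412 : Equiv.Perm (Fin 4) where
  toFun := ![2, 3, 0, 1]
  invFun := ![2, 3, 0, 1]
  left_inv := by decide
  right_inv := by decide

/-- The type of occurrences of the pattern `3412` in `π`, given by the increasing sequence of
positions of the four entries. -/
def Occ {n : ℕ} (π : Equiv.Perm (Fin n)) : Type :=
  {o : Fin 4 ↪o Fin n // ∀ a b : Fin 4, π (o a) < π (o b) ↔ p3412 a < p3412 b}

/-- The entry at position `i` is one of the four entries of the occurrence `o`. -/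
def Occ.Contains {n : ℕ} {π : Equiv.Perm (Fin n)} (o : Occ π) (i : Fin n) : Prop :=
  ∃ a : Fin 4, o.1 a = i

/-- The number of occurrences of `3412` in `π`. -/
noncomputable def numOcc {n : ℕ} (π : Equiv.Perm (Fin n)) : ℕ := Nat.card (Occ π)

/-- The generating function, over all `n ≥ 0`, of the number of involutions of `n` letters that
contain `3412` exactly `r` times. -/
noncomputable def invGF (r : ℕ) : PowerSeries ℚ :=
  PowerSeries.mk fun n =>
    (Nat.card {π : Equiv.Perm (Fin n) // IsInvolution π ∧ numOcc π = r} : ℚ)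

/-- The bipartite graph `G_π`: one part consists of the entries of `π` (named by their positions),
the other part of the occurrences of `3412`; an entry is joined to the occurrences it enters. -/
def occGraph {n : ℕ} (π : Equiv.Perm (Fin n)) : SimpleGraph (Fin n ⊕ Occ π) :=
  SimpleGraph.fromRel fun v w => ∃ (i : Fin n) (o : Occ π),
    v = Sum.inl i ∧ w = Sum.inr o ∧ o.Contains i

/-- The set of positions of the kernel of `π`: the entries in the connected component of `G_π` that
contains the smallest entry, together with the first entry of `π`. (For an involution the first
entry is in that component already, unless the smallest entry enters no occurrence.) -/
def kernelSet {n : ℕ} (π : Equiv.Perm (Fin n)) : Set (Fin n) :=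
  {i | ∃ z : Fin n, z.val = 0 ∧
    (i = z ∨ (occGraph π).Reachable (Sum.inl (π⁻¹ z)) (Sum.inl i))}

/-- `e` lists the positions `i_1 < ⋯ < i_s` of the kernel of `π`, and the kernel entries are
order-isomorphic to `ρ`. -/
def IsKernel {s n : ℕ} (ρ : Equiv.Perm (Fin s)) (π : Equiv.Perm (Fin n))
    (e : Fin s ↪o Fin n) : Prop :=
  Set.range e = kernelSet π ∧ ∀ k l : Fin s, π (e k) < π (e l) ↔ ρ k < ρ l

/-- `K t`: the set of all kernel shapes, of all sizes, of the involutions of `t` letters. -/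
def K (t : ℕ) : Set (Σ s : ℕ, Equiv.Perm (Fin s)) :=
  {ρ | ∃ π : Equiv.Perm (Fin t), IsInvolution π ∧ ∃ e : Fin ρ.1 ↪o Fin t, IsKernel ρ.2 π e}

theorem K_finite (t : ℕ) : (K t).Finite := by
  refine (((Finset.range (t + 1)).sigma
    fun s => (Finset.univ : Finset (Equiv.Perm (Fin s)))).finite_toSet).subset ?_
  rintro ⟨s, ρ⟩ ⟨π, _, e, _⟩
  have h : s ≤ t := by simpa using Fintype.card_le_of_injective e e.injective
  simp only [Finset.coe_sigma, Set.mem_sigma_iff, Finset.mem_coe, Finset.mem_range,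
    Finset.mem_univ, and_true]
  omega

/-- The cell `C_{mℓ}` cut out of `π` by the copy of `ρ` at the positions `e` (the set of positions
of its entries): positions strictly between `i_ℓ` and `i_{ℓ+1}`, values strictly between the `m`-th
and the `(m+1)`-st smallest entry of the copy, with no upper limit for the last `ℓ` or `m`. -/
def cell {s n : ℕ} (ρ : Equiv.Perm (Fin s)) (π : Equiv.Perm (Fin n)) (e : Fin s ↪o Fin n)
    (m l : Fin s) : Set (Fin n) :=
  {j | (e l < j ∧ ∀ k, l < k → j < e k) ∧
    (π (e (ρ⁻¹ m)) < π j ∧ ∀ k, m < k → π j < π (e (ρ⁻¹ k)))}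

/-- The cell `C_{mℓ}` is infeasible: whenever an involution `π` has a copy of `ρ` which, as the
kernel does, occupies a set of positions mapped to itself by `π`, the existence of an entry `a` of
`π` in the cell implies an occurrence of `3412` that contains `a`, two entries of the copy, and
another entry of `π`. -/
def Infeasible {s : ℕ} (ρ : Equiv.Perm (Fin s)) (m l : Fin s) : Prop :=
  ∀ (n : ℕ) (π : Equiv.Perm (Fin n)) (e : Fin s ↪o Fin n), IsInvolution π →
    (∀ k, π (e k) = e (ρ k)) → ∀ a ∈ cell ρ π e m l,
      ∃ o : Occ π, o.Contains a ∧ ∃ x y : Fin s, x ≠ y ∧ o.Contains (e x) ∧ o.Contains (e y)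

/-- In every involution with kernel shape `ρ`, the entries in the cell `C_{mℓ}` of the kernel cell
decomposition decrease from left to right. -/
def AlwaysDecreasing {s : ℕ} (ρ : Equiv.Perm (Fin s)) (m l : Fin s) : Prop :=
  ∀ (n : ℕ) (π : Equiv.Perm (Fin n)) (e : Fin s ↪o Fin n), IsInvolution π →
    IsKernel ρ π e → StrictAntiOn π (cell ρ π e m l)

/-- Free-cells: feasible cells whose content is not forced to be decreasing, that is, which may
contain an occurrence of `12`. -/
def freeCells {s : ℕ} (ρ : Equiv.Perm (Fin s)) : Set (Fin s × Fin s) :=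
  {C | ¬ Infeasible ρ C.1 C.2 ∧ ¬ AlwaysDecreasing ρ C.1 C.2}

/-- Diagonal-decreasing-cells. -/
def diagDecCells {s : ℕ} (ρ : Equiv.Perm (Fin s)) : Set (Fin s × Fin s) :=
  {C | ¬ Infeasible ρ C.1 C.2 ∧ C.1 = C.2 ∧ AlwaysDecreasing ρ C.1 C.2}

/-- Decreasing-cells `C_{mℓ}` that lie above the diagonal, `m > ℓ`. -/
def decCells {s : ℕ} (ρ : Equiv.Perm (Fin s)) : Set (Fin s × Fin s) :=
  {C | ¬ Infeasible ρ C.1 C.2 ∧ C.2 < C.1 ∧ AlwaysDecreasing ρ C.1 C.2}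

/-- `f(ρ)` -/
noncomputable def f {s : ℕ} (ρ : Equiv.Perm (Fin s)) : ℕ := (freeCells ρ).ncard

/-- `dd(ρ)` -/
noncomputable def dd {s : ℕ} (ρ : Equiv.Perm (Fin s)) : ℕ := (diagDecCells ρ).ncard

/-- `d(ρ)` -/
noncomputable def d {s : ℕ} (ρ : Equiv.Perm (Fin s)) : ℕ := (decCells ρ).ncard

/-- The sum of `∏ j, I_{r_j}(x)` over all `r_1, …, r_k ≥ 0` with `r_1 + ⋯ + r_k = r - c`, the
difference being taken in the integers: the sum is empty if `c > r`. -/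
noncomputable def compSum (k r c : ℕ) : PowerSeries ℚ :=
  if c ≤ r then ∑ q ∈ Finset.Nat.antidiagonalTuple k (r - c), ∏ j, invGF (q j) else 0

end InvKernel

/-! Draw an involution as arcs joining each position `i` to `π i`. Crossing arcs form a 3412, and
mirroring an occurrence across the diagonal gives an occurrence. The kernel, called the core below,
is cut out by its positions. The theorem says that involutions with a given kernel shape correspond
to independent fillings of the feasible cells, and that occurrences outside the core are counted
cell by cell.

The geometric heart is `Tame.occ_core_or_gap`: an occurrence lies in the core or in one diagonal
cell. A feasible cell is treated as a potential arc, a `Cut`, through the core. `Cut.types` lists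
how occurrences inside the core can meet such an arc. Since the core is connected, two crossing cuts
cannot be separated by it (`Cut.no_sep_left`, `Cut.no_sep_right`), and an arc enclosing core entries
lies beneath two increasing core entries (`Cut.exists_pair`). Hence crossing arcs outside the core
span no core entry (`Tame.no_core_of_cross`).

Consequences for a shape: a column has at most one feasible cell (`Shape.feasible_unique`), so
transposition pairs columns through `mate`. A cell off the diagonal always decreases, so together
with its transpose it contributes 1/(1-x^2). A forced diagonal cell contributes 1/(1-x). A free cell
is diagonal and holds an arbitrary involution. Conversely, feasibility and forced decrease alone
make a copy of the shape the kernel (`Fits.isKernel`), so every filling occurs. A second formal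
variable marks occurrences, and its coefficient gives the inner sum.

Finally, growing the kernel by one occurrence and its mirror image adds at most two entries per new
occurrence. So a kernel with c occurrences has at most 2c+2 entries (`exists_kerSet`). Appending
fixed points puts each shape of size at most t into K_t, hence K_{2r+2} contains all shapes that
matter. -/

namespace InvKernel

/-! ### Occurrences, and the types of core entries relative to an arc -/

section Generic

variable {α : Type*} [LinearOrder α]

/-- The entries of `π` at the positions `a`, `b`, `c`, `d` form an occurrence of `3412`. -/
def Is3412 (π : α → α) (a b c d : α) : Prop :=
  a < b ∧ b < c ∧ c < d ∧ π c < π d ∧ π d < π a ∧ π a < π b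

theorem Is3412.mirror {π : α → α} (hπ : ∀ x, π (π x) = x) {a b c d : α} (h : Is3412 π a b c d) :
    Is3412 π (π c) (π d) (π a) (π b) := by
  obtain ⟨h1, h2, h3, h4, h5, h6⟩ := h
  simp only [Is3412, hπ]
  exact ⟨h4, h5, h6, h1, h2, h3⟩

/-- Two crossing arcs of an involution form an occurrence of `3412`. -/
theorem is3412_of_cross {π : α → α} (hπ : ∀ x, π (π x) = x) {x p : α} (h1 : x < p)
    (h2 : p < π x) (h3 : π x < π p) : Is3412 π x p (π x) (π p) := by
  simp only [Is3412, hπ]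
  exact ⟨h1, h2, h3, h1, h2, h3⟩

/-- `E` is connected by the occurrences inside it, up to the involution `π`. -/
def Conn (π : α → α) (E : Set α) : Prop :=
  ∀ A ⊆ E, (∀ x ∈ A, π x ∈ A) → A.Nonempty → A ≠ E →
    ∃ a b c d, Is3412 π a b c d ∧ a ∈ E ∧ b ∈ E ∧ c ∈ E ∧ d ∈ E ∧
      (a ∈ A ∨ b ∈ A ∨ c ∈ A ∨ d ∈ A) ∧ ¬ (a ∈ A ∧ b ∈ A ∧ c ∈ A ∧ d ∈ A)

/-- A point inserted at the position just after `l`, with value just above `m`, enters no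
occurrence of `3412` with three entries from `E`. -/
structure CutOne (π : α → α) (E : Set α) (l m : α) : Prop where
  fst : ∀ x ∈ E, ∀ y ∈ E, ∀ z ∈ E, l < x → x < y → y < z → m < π x → π y < π z → ¬ π z ≤ m
  snd : ∀ w ∈ E, ∀ y ∈ E, ∀ z ∈ E, w ≤ l → l < y → y < z → π y < π z → π z < π w → ¬ π w ≤ m
  trd : ∀ w ∈ E, ∀ x ∈ E, ∀ z ∈ E, w < x → x ≤ l → l < z → m < π z → π z < π w → ¬ π w < π x
  fth : ∀ w ∈ E, ∀ x ∈ E, ∀ y ∈ E, w < x → x < y → y ≤ l → π y ≤ m → m < π w → ¬ π w < π x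

/-- An arc from just after `l` to just after `m` creates no occurrence of `3412` together with
at least two entries from `E`. -/
structure Cut (π : α → α) (E : Set α) (l m : α) : Prop where
  le : l ≤ m
  up : CutOne π E l m
  down : CutOne π E m l
  cross_left : ∀ x ∈ E, x ≤ l → l < π x → ¬ π x ≤ m
  cross_right : ∀ x ∈ E, l < x → x ≤ m → ¬ m < π x

variable {π : α → α} {E : Set α}

/-- The possible places of a core arc, seen from its end `x`, relative to an arc from just after `l`
to just after `m`. A core arc passing over it is seen as `OverUp` from its left end and as
`OverDown` from its right end. -/
def LeftOf (π : α → α) (l : α) (x : α) : Prop := x ≤ l ∧ π x ≤ l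
def RightOf (π : α → α) (m : α) (x : α) : Prop := m < x ∧ m < π x
def Inside (π : α → α) (l m : α) (x : α) : Prop := l < x ∧ x ≤ m ∧ l < π x ∧ π x ≤ m
def OverUp (π : α → α) (l m : α) (x : α) : Prop := x ≤ l ∧ m < π x
def OverDown (π : α → α) (l m : α) (x : α) : Prop := m < x ∧ π x ≤ l

theorem Cut.classify (hπ : ∀ x, π (π x) = x) (hE : ∀ x ∈ E, π x ∈ E) {l m : α} (h : Cut π E l m)
    {x : α} (hx : x ∈ E) : LeftOf π l x ∨ RightOf π m x ∨ Inside π l m x ∨ OverUp π l m x ∨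
      OverDown π l m x := by
  have h1 := h.cross_left x hx
  have h2 := h.cross_left (π x) (hE x hx)
  have h3 := h.cross_right x hx
  have h4 := h.cross_right (π x) (hE x hx)
  have h0 := h.le
  rw [hπ] at h2 h4
  unfold LeftOf RightOf Inside OverUp OverDown
  grind

/-- The forbidden patterns with three core entries leave only these combinations. In particular an
occurrence never joins an entry inside the arc to one on its left or right, and it mixes inside
entries with arcs passing over only two and two. -/
theorem Cut.types (hπ : ∀ x, π (π x) = x) (hE : ∀ x ∈ E, π x ∈ E) {l m : α} (h : Cut π E l m)
    {w x y z : α} (hw : w ∈ E) (hx : x ∈ E) (hy : y ∈ E) (hz : z ∈ E) (ho : Is3412 π w x y z) :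
    (LeftOf π l w ∧ LeftOf π l y ∧ (LeftOf π l x ∨ OverUp π l m x) ∧
      (LeftOf π l z ∨ OverDown π l m z)) ∨
    (RightOf π m x ∧ RightOf π m z ∧ (RightOf π m w ∨ OverUp π l m w) ∧
      (RightOf π m y ∨ OverDown π l m y)) ∨
    (Inside π l m w ∧ Inside π l m x ∧ Inside π l m y ∧ Inside π l m z) ∨
    ((OverUp π l m w ∨ OverDown π l m w) ∧ (OverUp π l m x ∨ OverDown π l m x) ∧
      (OverUp π l m y ∨ OverDown π l m y) ∧ (OverUp π l m z ∨ OverDown π l m z)) ∨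
    (OverUp π l m w ∧ OverUp π l m x ∧ Inside π l m y ∧ Inside π l m z) ∨
    (Inside π l m w ∧ Inside π l m x ∧ OverDown π l m y ∧ OverDown π l m z) := by
  have a1 := h.up.fst x hx y hy z hz
  have a2 := h.up.snd w hw y hy z hz
  have a3 := h.up.trd w hw x hx z hz
  have a4 := h.up.fth w hw x hx y hy
  have b1 := h.down.fst x hx y hy z hz
  have b2 := h.down.snd w hw y hy z hz
  have b3 := h.down.trd w hw x hx z hz
  have b4 := h.down.fth w hw x hx y hy
  have h0 := h.le
  obtain ⟨o1, o2, o3, o4, o5, o6⟩ := ho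
  have cw := h.classify hπ hE hw
  have cx := h.classify hπ hE hx
  have cy := h.classify hπ hE hy
  have cz := h.classify hπ hE hz
  clear h
  unfold LeftOf RightOf Inside OverUp OverDown at *
  generalize π w = w' at *
  generalize π x = x' at *
  generalize π y = y' at *
  generalize π z = z' at *
  clear hπ hE hw hx hy hz
  grind (splits := 60)

end Generic

/-! ### A connected core does not separate crossing cuts -/

section Generic

variable {α : Type*} [LinearOrder α] {π : α → α} {E : Set α}

theorem inside_map (hπ : ∀ x, π (π x) = x) {l m x : α} (h : Inside π l m x) :
    Inside π l m (π x) := by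
  obtain ⟨h1, h2, h3, h4⟩ := h
  exact ⟨h3, h4, by rwa [hπ], by rwa [hπ]⟩

theorem leftOf_map (hπ : ∀ x, π (π x) = x) {l x : α} (h : LeftOf π l x) : LeftOf π l (π x) :=
  ⟨h.2, by rw [hπ]; exact h.1⟩

theorem rightOf_map (hπ : ∀ x, π (π x) = x) {l x : α} (h : RightOf π l x) : RightOf π l (π x) :=
  ⟨h.2, by rw [hπ]; exact h.1⟩

/-- Two arcs outside the core that cross are not separated by the core. -/
theorem Cut.no_sep_left (hπ : ∀ x, π (π x) = x) (hE : ∀ x ∈ E, π x ∈ E) (hc : Conn π E)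
    {b : α} (hb : b ∈ E) {l₁ m₁ l₂ m₂ : α} (h₁ : Cut π E l₁ m₁) (h₂ : Cut π E l₂ m₂)
    (hbl : b ≤ l₁) (hlm : l₂ ≤ m₁) (hm : m₁ ≤ m₂) {z : α} (hz : z ∈ E)
    (hz₁ : l₁ < z) : ¬ z ≤ l₂ := by
  intro hz₂
  have key : ∀ x ∈ E, Inside π l₁ m₁ x → LeftOf π l₂ x ∨ Inside π l₂ m₂ x := by
    intro x hx hi
    have := h₂.classify hπ hE hx
    unfold LeftOf RightOf Inside OverUp OverDown at *
    grind
  obtain ⟨w, x, y, t, ho, hw, hx, hy, ht, hA, hnA⟩ :=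
    -- An occurrence leaving this set would be of mixed type for the first cut, with an entry over
    -- it that must be left of the second cut. Since `l₂ ≤ m₁ ≤ m₂`, these are incompatible.
    hc {x | x ∈ E ∧ Inside π l₁ m₁ x ∧ LeftOf π l₂ x} (fun x hx => hx.1)
      (fun x hx => ⟨hE x hx.1, inside_map hπ hx.2.1, leftOf_map hπ hx.2.2⟩)
      ⟨z, hz, by
        have := h₁.classify hπ hE hz
        have := h₂.classify hπ hE hz
        unfold LeftOf RightOf Inside OverUp OverDown at *
        grind⟩
      (fun h => by
        have := (Set.ext_iff.1 h b).2 hb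
        exact absurd this.2.1.1 (not_lt.2 hbl))
  have t1 := h₁.types hπ hE hw hx hy ht ho
  have t2 := h₂.types hπ hE hw hx hy ht ho
  have hl1 := h₁.le
  have hl2 := h₂.le
  simp only [Set.mem_ofPred_eq, hw, hx, hy, ht, true_and] at hA hnA
  have dis1 : ∀ x, Inside π l₁ m₁ x → ¬ LeftOf π l₁ x ∧ ¬ RightOf π m₁ x ∧ ¬ OverUp π l₁ m₁ x ∧
      ¬ OverDown π l₁ m₁ x := by
    intro x; simp only [LeftOf, RightOf, Inside, OverUp, OverDown]; grind
  have dis2 : ∀ x, LeftOf π l₂ x → ¬ Inside π l₂ m₂ x ∧ ¬ RightOf π m₂ x ∧ ¬ OverUp π l₂ m₂ x ∧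
      ¬ OverDown π l₂ m₂ x := by
    intro x; simp only [LeftOf, RightOf, Inside, OverUp, OverDown]; grind
  have dis3 : ∀ x, Inside π l₁ m₁ x → ¬ RightOf π m₂ x ∧ ¬ OverUp π l₂ m₂ x ∧
      ¬ OverDown π l₂ m₂ x := by
    intro x; simp only [RightOf, Inside, OverUp, OverDown]; grind
  have dis4 : ∀ x, LeftOf π l₂ x → ¬ RightOf π m₁ x ∧ ¬ OverUp π l₁ m₁ x ∧
      ¬ OverDown π l₁ m₁ x := by
    intro x; simp only [LeftOf, RightOf, OverUp, OverDown]; grind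
  have d1 := dis1 w
  have d2 := dis1 x
  have d3 := dis1 y
  have d4 := dis1 t
  have e1 := dis2 w
  have e2 := dis2 x
  have e3 := dis2 y
  have e4 := dis2 t
  have f1 := dis3 w
  have f2 := dis3 x
  have f3 := dis3 y
  have f4 := dis3 t
  have g1 := dis4 w
  have g2 := dis4 x
  have g3 := dis4 y
  have g4 := dis4 t
  clear dis1 dis2 dis3 dis4 key
  clear h₁ h₂ hc
  grind (splits := 60)

/-- The counterpart of `Cut.no_sep_left` under reverse-complement, which fixes 3412. The set split
off now consists of the core entries inside the second cut and right of the first; it misses `b`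
because `b ≤ l₁ ≤ l₂`. -/
theorem Cut.no_sep_right (hπ : ∀ x, π (π x) = x) (hE : ∀ x ∈ E, π x ∈ E) (hc : Conn π E)
    {b : α} (hb : b ∈ E) {l₁ m₁ l₂ m₂ : α} (h₁ : Cut π E l₁ m₁) (h₂ : Cut π E l₂ m₂)
    (hbl : b ≤ l₁) (hl : l₁ ≤ l₂) (hlm : l₂ ≤ m₁) {z : α} (hz : z ∈ E)
    (hz₁ : m₁ < z) : ¬ z ≤ m₂ := by
  intro hz₂
  obtain ⟨w, x, y, t, ho, hw, hx, hy, ht, hA, hnA⟩ :=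
    hc {x | x ∈ E ∧ Inside π l₂ m₂ x ∧ RightOf π m₁ x} (fun x hx => hx.1)
      (fun x hx => ⟨hE x hx.1, inside_map hπ hx.2.1, rightOf_map hπ hx.2.2⟩)
      ⟨z, hz, by
        have := h₁.classify hπ hE hz
        have := h₂.classify hπ hE hz
        unfold LeftOf RightOf Inside OverUp OverDown at *
        grind⟩
      (fun h => by
        have := (Set.ext_iff.1 h b).2 hb
        exact absurd this.2.1.1 (not_lt.2 (hbl.trans hl)))
  have t1 := h₁.types hπ hE hw hx hy ht ho
  have t2 := h₂.types hπ hE hw hx hy ht ho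
  have hl1 := h₁.le
  have hl2 := h₂.le
  simp only [Set.mem_ofPred_eq, hw, hx, hy, ht, true_and] at hA hnA
  have dis1 : ∀ x, Inside π l₂ m₂ x → ¬ LeftOf π l₂ x ∧ ¬ RightOf π m₂ x ∧ ¬ OverUp π l₂ m₂ x ∧
      ¬ OverDown π l₂ m₂ x := by
    intro x; simp only [LeftOf, RightOf, Inside, OverUp, OverDown]; grind
  have dis2 : ∀ x, RightOf π m₁ x → ¬ Inside π l₁ m₁ x ∧ ¬ LeftOf π l₁ x ∧ ¬ OverUp π l₁ m₁ x ∧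
      ¬ OverDown π l₁ m₁ x := by
    intro x; simp only [LeftOf, RightOf, Inside, OverUp, OverDown]; grind
  have dis3 : ∀ x, Inside π l₂ m₂ x → ¬ LeftOf π l₁ x ∧ ¬ OverUp π l₁ m₁ x ∧
      ¬ OverDown π l₁ m₁ x := by
    intro x; simp only [LeftOf, Inside, OverUp, OverDown]; grind
  have dis4 : ∀ x, RightOf π m₁ x → ¬ LeftOf π l₂ x ∧ ¬ OverUp π l₂ m₂ x ∧
      ¬ OverDown π l₂ m₂ x := by
    intro x; simp only [LeftOf, RightOf, OverUp, OverDown]; grind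
  have d1 := dis1 w
  have d2 := dis1 x
  have d3 := dis1 y
  have d4 := dis1 t
  have e1 := dis2 w
  have e2 := dis2 x
  have e3 := dis2 y
  have e4 := dis2 t
  have f1 := dis3 w
  have f2 := dis3 x
  have f3 := dis3 y
  have f4 := dis3 t
  have g1 := dis4 w
  have g2 := dis4 x
  have g3 := dis4 y
  have g4 := dis4 t
  clear dis1 dis2 dis3 dis4
  clear h₁ h₂ hc
  grind (splits := 60)

/-- Arcs through the core from a feasible cell off the diagonal lie below an increasing pair
of the core. -/
theorem Cut.exists_pair (hπ : ∀ x, π (π x) = x) (hE : ∀ x ∈ E, π x ∈ E) (hc : Conn π E)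
    {b : α} (hb : b ∈ E) {l m : α} (h : Cut π E l m) (hbl : b ≤ l) {z : α} (hz : z ∈ E)
    (hz₁ : l < z) (hz₂ : z ≤ m) :
    ∃ x ∈ E, ∃ y ∈ E, x < y ∧ π x < π y ∧ y ≤ l ∧ m < π x := by
  obtain ⟨w, x, y, t, ho, hw, hx, hy, ht, hA, hnA⟩ :=
    hc {x | x ∈ E ∧ Inside π l m x} (fun x hx => hx.1)
      (fun x hx => ⟨hE x hx.1, inside_map hπ hx.2⟩)
      ⟨z, hz, by
        have := h.classify hπ hE hz
        unfold LeftOf RightOf Inside OverUp OverDown at *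
        grind⟩
      (fun h => by
        have := (Set.ext_iff.1 h b).2 hb
        exact absurd this.2.1 (not_lt.2 hbl))
  have t1 := h.types hπ hE hw hx hy ht ho
  have hl1 := h.le
  simp only [Set.mem_ofPred_eq, hw, hx, hy, ht, true_and] at hA hnA
  have dis1 : ∀ x, Inside π l m x → ¬ LeftOf π l x ∧ ¬ RightOf π m x ∧ ¬ OverUp π l m x ∧
      ¬ OverDown π l m x := by
    intro x; simp only [LeftOf, RightOf, Inside, OverUp, OverDown]; grind
  have d1 := dis1 w
  have d2 := dis1 x
  have d3 := dis1 y
  have d4 := dis1 t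
  -- An occurrence leaving the inside of the cut has two entries there and two over it. In the
  -- second case the mirror image supplies the pair.
  have t2 : (OverUp π l m w ∧ OverUp π l m x) ∨ (OverDown π l m y ∧ OverDown π l m t) := by
    clear h hc dis1
    grind
  obtain ⟨o1, o2, o3, o4, o5, o6⟩ := ho
  rcases t2 with t2 | t2
  · exact ⟨w, hw, x, hx, o1, o6, t2.2.1, t2.1.2⟩
  · refine ⟨π y, hE y hy, π t, hE t ht, o4, ?_, t2.2.2, ?_⟩
    · rwa [hπ, hπ]
    · rw [hπ]; exact t2.1.1

end Generic

/-! ### Tame cores: an occurrence lies in the core or in one diagonal cell -/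

section Generic

variable {α : Type*} [LinearOrder α] {π : α → α} {E : Set α}

/-- The occurrences that use at least two entries of the core `E` and some entry outside it are
excluded, in those shapes that depend on the cells of the entries only. -/
structure Tame (π : α → α) (E : Set α) : Prop where
  fst : ∀ a b c d, Is3412 π a b c d → b ∈ E → c ∈ E → d ∈ E → a ∈ E
  snd : ∀ a b c d, Is3412 π a b c d → a ∈ E → c ∈ E → d ∈ E → b ∈ E
  cross_left : ∀ x ∈ E, ∀ p ∉ E, x < p → p < π x → ¬ π x < π p
  cross_right : ∀ x ∈ E, ∀ p ∉ E, p < x → x < π p → ¬ π p < π x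
  two : ∀ a b c d, Is3412 π a b c d → a ∈ E → b ∈ E → c ∉ E → d ∉ E →
    ∃ z ∈ E, (c < z ∧ z < d) ∨ (π c < z ∧ z < π d)

/-- Mirroring exchanges the first two entries with the last two, so `fst` and `snd` yield the other
two conditions. -/
theorem Tame.trd (h : Tame π E) (hπ : ∀ x, π (π x) = x) (hE : ∀ x ∈ E, π x ∈ E) (a b c d : α)
    (ho : Is3412 π a b c d) (ha : a ∈ E) (hb : b ∈ E) (hd : d ∈ E) : c ∈ E := by
  have := hE _ (h.fst _ _ _ _ (ho.mirror hπ) (hE _ hd) (hE _ ha) (hE _ hb))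
  rwa [hπ] at this

theorem Tame.fth (h : Tame π E) (hπ : ∀ x, π (π x) = x) (hE : ∀ x ∈ E, π x ∈ E) (a b c d : α)
    (ho : Is3412 π a b c d) (ha : a ∈ E) (hb : b ∈ E) (hc : c ∈ E) : d ∈ E := by
  have := hE _ (h.snd _ _ _ _ (ho.mirror hπ) (hE _ hc) (hE _ ha) (hE _ hb))
  rwa [hπ] at this

theorem not_mem_map {β : Type*} {π : β → β} {E : Set β} (hπ : ∀ x, π (π x) = x)
    (hE : ∀ x ∈ E, π x ∈ E) {p : β} (hp : p ∉ E) :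
    π p ∉ E := fun h => hp (by have := hE _ h; rwa [hπ] at this)

/-- Neither `p` nor `π p` is in the core, so the weak inequalities of `CutOne` become strict and `p`
itself plays the inserted point. -/
theorem Tame.cutOne (h : Tame π E) (hπ : ∀ x, π (π x) = x) (hE : ∀ x ∈ E, π x ∈ E) {p : α}
    (hp : p ∉ E) : CutOne π E p (π p) := by
  have ne : ∀ x ∈ E, x ≤ p → x < p := fun x hx hxp => lt_of_le_of_ne hxp (by grind)
  have ne' : ∀ x ∈ E, π x ≤ π p → π x < π p := fun x hx hxp => lt_of_le_of_ne hxp (by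
    intro h'
    apply hp
    rw [← hπ p, ← h', hπ]
    exact hx)
  constructor
  · intro x hx y hy z hz h1 h2 h3 h4 h5 h6
    exact hp (h.fst p x y z ⟨h1, h2, h3, h5, ne' _ hz h6, h4⟩ hx hy hz)
  · intro w hw y hy z hz h1 h2 h3 h4 h5 h6
    exact hp (h.snd w p y z ⟨ne _ hw h1, h2, h3, h4, h5, ne' _ hw h6⟩ hw hy hz)
  · intro w hw x hx z hz h1 h2 h3 h4 h5 h6
    exact hp (h.trd hπ hE w x p z ⟨h1, ne _ hx h2, h3, h4, h5, h6⟩ hw hx hz)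
  · intro w hw x hx y hy h1 h2 h3 h4 h5 h6
    exact hp (h.fth hπ hE w x y p ⟨h1, h2, ne _ hy h3, ne' _ hy h4, h5, h6⟩ hw hx hy)

theorem Tame.cut (h : Tame π E) (hπ : ∀ x, π (π x) = x) (hE : ∀ x ∈ E, π x ∈ E) {p : α}
    (hp : p ∉ E) (hle : p ≤ π p) : Cut π E p (π p) := by
  have hp' := not_mem_map hπ hE hp
  have h2 := h.cutOne hπ hE hp'
  rw [hπ] at h2
  refine ⟨hle, h.cutOne hπ hE hp, h2, ?_, ?_⟩
  · intro x hx h1 h2 h3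
    have h4 : x ≠ p := by rintro rfl; exact hp hx
    have h5 : π x ≠ π p := fun h' => h4 (by rw [← hπ x, h', hπ])
    exact h.cross_left x hx p hp (lt_of_le_of_ne h1 h4) h2 (lt_of_le_of_ne h3 h5)
  · intro x hx h1 h2 h3
    have h4 : x ≠ π p := by rintro rfl; exact hp' hx
    exact h.cross_right x hx p hp h1 (lt_of_le_of_ne h2 h4) h3

/-- Crossing arcs outside the core lie in one diagonal cell. -/
theorem Tame.no_core_of_cross (h : Tame π E) (hπ : ∀ x, π (π x) = x) (hE : ∀ x ∈ E, π x ∈ E)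
    (hc : Conn π E) {b : α} (hb : b ∈ E) (hbot : ∀ x, b ≤ x) {p q : α} (hp : p ∉ E) (hq : q ∉ E)
    (h1 : p < q) (h2 : q < π p) (h3 : π p < π q) {z : α} (hz : z ∈ E) : ¬ (p < z ∧ z < π q) := by
  have cp := h.cut hπ hE hp (h1.trans h2).le
  have cq := h.cut hπ hE hq (h2.trans h3).le
  have left : ∀ z ∈ E, p < z → ¬ z ≤ q := fun z hz hz' =>
    cp.no_sep_left hπ hE hc hb cq (hbot p) h2.le h3.le hz hz'
  have right : ∀ z ∈ E, π p < z → ¬ z ≤ π q := fun z hz hz' =>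
    cp.no_sep_right hπ hE hc hb cq (hbot p) h1.le h2.le hz hz'
  rintro ⟨hz1, hz2⟩
  have hz3 : z ≤ π p := by
    by_contra h'
    exact right z hz (not_le.1 h') hz2.le
  -- The core entry `z` lies beneath the arc of `p`, so a pair of core arcs passes over it, and over
  -- `π q` as well. This pair and `p`, `q` form a 3412, and `two` then puts a core entry between `p`
  -- and `q` or between `π p` and `π q`.
  obtain ⟨x, hx, y, hy, g1, g2, g3, g4⟩ := cp.exists_pair hπ hE hc hb (hbot p) hz hz1 hz3
  have g5 : π q < π x := not_le.1 (right _ (hE x hx) g4)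
  have g6 : y < p := lt_of_le_of_ne g3 (by rintro rfl; exact hp hy)
  obtain ⟨z', hz', h' | h'⟩ := h.two x y p q ⟨g1, g6, h1, h3, g5, g2⟩ hx hy hp hq
  · exact left z' hz' h'.1 h'.2.le
  · exact right z' hz' h'.1 h'.2.le

/-- The configuration of two core arcs crossing above two other entries. -/
theorem Tame.core_below (h : Tame π E) (hπ : ∀ x, π (π x) = x) (hE : ∀ x ∈ E, π x ∈ E)
    (hc : Conn π E) {o : α} (ho : o ∈ E) (hbot : ∀ x, o ≤ x) {a b c d : α}
    (hO : Is3412 π a b c d) (hab : b < π a) (ha : a ∈ E) (hb : b ∈ E) : c ∈ E ∧ d ∈ E := by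
  by_cases hcE : c ∈ E
  · exact ⟨hcE, h.fth hπ hE _ _ _ _ hO ha hb hcE⟩
  by_cases hdE : d ∈ E
  · exact ⟨h.trd hπ hE _ _ _ _ hO ha hb hdE, hdE⟩
  exfalso
  have hcE' := not_mem_map hπ hE hcE
  have hdE' := not_mem_map hπ hE hdE
  have hO' := hO
  obtain ⟨o1, o2, o3, o4, o5, o6⟩ := hO'
  have hn : ∀ x ∈ E, x ≠ c ∧ x ≠ d ∧ x ≠ π c ∧ x ≠ π d := fun x hx =>
    ⟨fun e => hcE (e ▸ hx), fun e => hdE (e ▸ hx), fun e => hcE' (e ▸ hx), fun e => hdE' (e ▸ hx)⟩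
  have inj : ∀ x y, π x = π y → x = y := fun x y e => by rw [← hπ x, e, hπ]
  have cl : ∀ x ∈ E, ∀ p ∉ E, x < p → p < π x → ¬ π x < π p := h.cross_left
  have cr : ∀ x ∈ E, ∀ p ∉ E, p < x → x < π p → ¬ π p < π x := h.cross_right
  have hπc := hπ c
  have hπd := hπ d
  have haE := hE a ha
  have hbE := hE b hb
  have x1 := cl b hb (π c) hcE'
  have x2 := cl a ha (π c) hcE'
  have x3 := cl b hb (π d) hdE'
  have x4 := cl a ha (π d) hdE'
  have y1 := cr b hb (π c) hcE'
  have y2 := cr a ha (π c) hcE'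
  have y3 := cr b hb (π d) hdE'
  have y4 := cr a ha (π d) hdE'
  have x1' := cl b hb c hcE
  have x2' := cl a ha c hcE
  have x3' := cl b hb d hdE
  have x4' := cl a ha d hdE
  have n1 := hn _ ha
  have n2 := hn _ hb
  have n3 := hn _ haE
  have n4 := hn _ hbE
  -- If `π d < c`, the arcs at `c` and `d` cross, and their whole span is free of core entries.
  have hN : π d < c → ∀ z ∈ E, ¬ (π c < z ∧ z < d) := by
    intro hlt z hz
    have := h.no_core_of_cross hπ hE hc ho hbot hcE' hdE' o4 (by rwa [hπ]) (by rwa [hπ, hπ]) hz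
    rwa [hπ] at this
  rw [hπ] at x1 x2 x3 x4 y1 y2 y3 y4
  obtain ⟨z, hz, h'⟩ := h.two a b c d hO ha hb hcE hdE
  have hNa := fun h => hN h a ha
  have hNb := fun h => hN h b hb
  have hNz := fun h => hN h z hz
  have hNz' := fun h => hN h _ (hE z hz)
  -- The arcs at `c` and `d` lie beneath both core arcs. Otherwise one of them crosses a core arc,
  -- or `a` lies in the span excluded by `hN`.
  have c1 : b < π c ∧ c < π a := by
    clear hn inj cl cr hN hE hπ hbot hc h
    rcases lt_trichotomy (π c) b with g1 | g1 | g1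
    · rcases lt_trichotomy c (π b) with g2 | g2 | g2
      · exact absurd g2 (y1 g1 o2)
      · exact absurd g2.symm n4.1
      · rcases lt_trichotomy (π c) a with g3 | g3 | g3
        · rcases lt_trichotomy (π d) b with g4 | g4 | g4
          · rcases lt_trichotomy (π d) a with g5 | g5 | g5
            · exact absurd ⟨g3, by order⟩ (hNa (by order))
            · exact absurd g5.symm n1.2.2.2
            · exact absurd (by order) (x4 g5 (by order))
          · exact absurd g4.symm n2.2.2.2
          · exact absurd (by order) (x3 g4 (by order))
        · exact absurd g3.symm n1.2.2.1
        · exact absurd (by order) (x2 g3 (by order))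
    · exact absurd g1.symm n2.2.2.1
    · rcases lt_trichotomy c (π a) with g2 | g2 | g2
      · exact ⟨g1, g2⟩
      · exact absurd g2.symm n3.1
      · exact absurd g2 (x2 (by order) (by order))
  have c2 : b < π d ∧ d < π a := by
    clear hn inj cl cr hN hE hπ hbot hc h
    refine ⟨c1.1.trans o4, ?_⟩
    rcases lt_trichotomy d (π a) with g2 | g2 | g2
    · exact g2
    · exact absurd g2.symm n3.2.1
    · exact absurd g2 (x4 (by order) (by order))
  have nz := hn z hz
  have nz' := hn _ (hE z hz)
  have z1 := cl z hz c hcE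
  have z2 := cl z hz d hdE
  have z3 := cl z hz (π c) hcE'
  have z4 := cl z hz (π d) hdE'
  have w1 := cl (π z) (hE z hz) c hcE
  have w2 := cl (π z) (hE z hz) d hdE
  have w3 := cl (π z) (hE z hz) (π c) hcE'
  have w4 := cl (π z) (hE z hz) (π d) hdE'
  have u1 := cr z hz c hcE
  have u2 := cr z hz d hdE
  have u3 := cr z hz (π c) hcE'
  have u4 := cr z hz (π d) hdE'
  have v1 := cr (π z) (hE z hz) c hcE
  have v2 := cr (π z) (hE z hz) d hdE
  have v3 := cr (π z) (hE z hz) (π c) hcE'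
  have v4 := cr (π z) (hE z hz) (π d) hdE'
  have s1 := inj z a
  have s2 := inj z b
  -- Unless its arc crosses that of `c` or `d`, the separating core entry `z`, or `π z`, completes
  -- `a`, `b` and one of `c`, `d` to an occurrence with three core entries, which is excluded.
  have q1 : ¬ Is3412 π a b z d := fun hq => hdE (h.fth hπ hE _ _ _ _ hq ha hb hz)
  have q2 : ¬ Is3412 π a b c z := fun hq => hcE (h.trd hπ hE _ _ _ _ hq ha hb hz)
  have q3 : ¬ Is3412 π a b (π z) d := fun hq => hdE (h.fth hπ hE _ _ _ _ hq ha hb (hE z hz))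
  have q4 : ¬ Is3412 π a b c (π z) := fun hq => hcE (h.trd hπ hE _ _ _ _ hq ha hb (hE z hz))
  simp only [Is3412, hπ] at *
  clear hn inj cl cr hN
  rcases h' with h' | h'
  · have : π a < π z := by grind
    grind (splits := 30)
  · have : π z < b := by grind
    grind (splits := 30)

set_option maxHeartbeats 1000000 in
/-- The configuration of two crossing arcs outside the core above two other entries. -/
theorem Tame.gap_below (h : Tame π E) (hπ : ∀ x, π (π x) = x) (hE : ∀ x ∈ E, π x ∈ E)
    (hc : Conn π E) {o : α} (ho : o ∈ E) (hbot : ∀ x, o ≤ x) {a b c d : α}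
    (hO : Is3412 π a b c d) (hab : b < π a) (ha : a ∉ E) (hb : b ∉ E) {z : α} (hz : z ∈ E) :
    (z < a ∧ z < π c) ∨ (d < z ∧ π b < z) := by
  have hN : ∀ p ∉ E, ∀ q ∉ E, p < q → q < π p → π p < π q → ∀ z ∈ E, ¬ (p < z ∧ z < π q) :=
    fun p hp q hq h1 h2 h3 z hz => h.no_core_of_cross hπ hE hc ho hbot hp hq h1 h2 h3 hz
  have mm : ∀ x, x ∉ E → π x ∉ E := fun x hx => not_mem_map hπ hE hx
  have mm' : ∀ x, π x ∉ E → x ∉ E := fun x hx => by have := mm _ hx; rwa [hπ] at this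
  have inj : ∀ x y, π x = y → x = π y := fun x y e => by rw [← e, hπ]
  obtain ⟨o1, o2, o3, o4, o5, o6⟩ := hO
  have gab := hN a ha b hb o1 hab o6
  have ha' := mm a ha
  have hb' := mm b hb
  have hπc := hπ c
  have hπd := hπ d
  have out : ∀ z ∈ E, z < a ∨ π b < z := by
    intro z hz
    rcases lt_trichotomy z a with g | rfl | g
    · exact Or.inl g
    · exact absurd hz ha
    · rcases lt_trichotomy z (π b) with g' | rfl | g'
      · exact absurd ⟨g, g'⟩ (gab z hz)
      · exact absurd hz hb'
      · exact Or.inr g'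
  have wide : ∀ p q, p < π b → π b < q → a < q → p < a → (∀ z ∈ E, ¬ (p < z ∧ z < q)) → p ∉ E →
      q ∉ E → ∀ z ∈ E, (z < a ∧ z < p) ∨ (π b < z ∧ q < z) := by
    intro p q h1 h2 h3 h4 h5 h6 h7 z hz
    rcases lt_trichotomy z p with g | rfl | g
    · exact Or.inl ⟨by order, g⟩
    · exact absurd hz h6
    · rcases lt_trichotomy z q with g' | rfl | g'
      · exact absurd ⟨g, g'⟩ (h5 z hz)
      · exact absurd hz h7
      · exact Or.inr ⟨by order, g'⟩
  -- Each crossing pair of arcs outside the core spans an interval without core entries, and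
  -- overlapping intervals merge. The cases are the relative places of the arcs at `c` and `d`.
  have key : ∀ z ∈ E, (z < a ∧ z < d ∧ z < π d ∧ z < π c) ∨
      (π b < z ∧ d < z ∧ π d < z ∧ c < z) := by
    -- Here the arcs at `c` and `d` enclose those at `a` and `b`. Either both are core arcs, and
    -- `two` for the mirrored occurrence puts a core entry between `a` and `π b`, or neither is, and
    -- they cross each other.
    have outer : π c < π d → π d < a → π b < c → ∀ z ∈ E,
        (z < a ∧ z < d ∧ z < π d ∧ z < π c) ∨ (π b < z ∧ d < z ∧ π d < z ∧ c < z) := by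
      intro g1 g2 g3 z hz
      by_cases hc' : π c ∈ E
      · have hd' : π d ∈ E := by
          by_contra hd'
          have := h.cross_left _ hc' _ hd' g1
          rw [hπ, hπ] at this
          exact this (by order) o3
        have hcE := hE _ hc'
        have hdE := hE _ hd'
        rw [hπ] at hcE hdE
        have hm : Is3412 π (π c) (π d) (π a) (π b) :=
          Is3412.mirror hπ ⟨o1, o2, o3, o4, o5, o6⟩
        obtain ⟨z', hz', hzz⟩ := h.two _ _ _ _ hm hc' hd' ha' hb'
        rw [hπ, hπ] at hzz
        have := gab z' hz'
        rcases hzz with hzz | hzz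
        · exact absurd ⟨by order, hzz.2⟩ this
        · exact absurd ⟨hzz.1, by order⟩ this
      · have hd' : π d ∉ E := by
          intro hd'
          have := h.cross_right _ hd' _ hc' g1
          rw [hπ, hπ] at this
          exact this (by order) o3
        have := hN _ hc' _ hd' g1 (by rw [hπ]; order) (by rwa [hπ, hπ])
        rw [hπ] at this
        rcases wide _ _ (by order) (by order) (by order) (by order) this hc' (mm' d hd') z hz
          with g | g
        · exact Or.inl ⟨g.1, by order, by order, g.2⟩
        · exact Or.inr ⟨g.1, g.2, by order, by order⟩
    have finish : π d ∉ E → (∀ z ∈ E, (z < a ∧ z < d ∧ z < π d) ∨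
        (π b < z ∧ d < z ∧ π d < z)) → ∀ z ∈ E,
        (z < a ∧ z < d ∧ z < π d ∧ z < π c) ∨ (π b < z ∧ d < z ∧ π d < z ∧ c < z) := by
      intro hd' kd
      by_cases g2 : a ≤ π c
      · intro z hz
        rcases kd z hz with g | g
        · exact Or.inl ⟨g.1, g.2.1, g.2.2, by order⟩
        · exact Or.inr ⟨g.1, g.2.1, g.2.2, by order⟩
      · have g2 := not_le.1 g2
        have hcE : c ∉ E := fun hcE => by
          rcases kd c hcE with g | g
          · exact absurd g.1 (by order)
          · exact absurd g.2.1 (by order)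
        have hc' := mm c hcE
        have low : ∀ z ∈ E, z < a → z < π c := by
          intro z hz hza
          rcases lt_trichotomy (π c) z with g3 | g3 | g3
          · exfalso
            rcases lt_trichotomy c (π b) with g | g | g
            · exact hN _ hc' b hb (by order) (by rwa [hπ]) (by rwa [hπ]) z hz ⟨g3, by order⟩
            · have := inj _ _ g.symm
              order
            · refine hN _ hc' _ hd' o4 (by rw [hπ]; order) (by rwa [hπ, hπ]) z hz ⟨g3, ?_⟩
              rw [hπ]; order
          · exact absurd (g3 ▸ hz) hc'
          · exact g3
        intro z hz
        rcases kd z hz with g | g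
        · exact Or.inl ⟨g.1, g.2.1, g.2.2, low z hz g.1⟩
        · exact Or.inr ⟨g.1, g.2.1, g.2.2, by order⟩
    rcases lt_trichotomy (π d) b with h1 | h1 | h1
    · rcases lt_trichotomy d (π b) with h2 | h2 | h2
      · have hd' : π d ∉ E := fun hd' => by
          have := h.cross_left _ hd' b hb h1
          rw [hπ] at this
          exact this (by order) h2
        refine finish hd' fun z hz => ?_
        have := hN _ hd' b hb h1 (by rw [hπ]; order) (by rwa [hπ]) z hz
        rcases out z hz with g | g
        · refine Or.inl ⟨g, by order, ?_⟩
          rcases lt_trichotomy (π d) z with g3 | g3 | g3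
          · exact absurd ⟨g3, by order⟩ this
          · exact absurd (g3 ▸ hz) hd'
          · exact g3
        · exact Or.inr ⟨g, by order, by order⟩
      · have := inj _ _ h2.symm
        order
      · rcases lt_trichotomy (π d) a with h3 | h3 | h3
        · rcases lt_trichotomy c (π b) with h4 | h4 | h4
          · have hc' : π c ∉ E := fun hc' => by
              have := h.cross_left _ hc' b hb (by order)
              rw [hπ] at this
              exact this o2 h4
            have n1 := hN _ hc' b hb (by order) (by rwa [hπ]) (by rwa [hπ])
            have hd' : π d ∉ E := fun hd' => n1 _ hd' ⟨o4, by order⟩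
            have n2 := hN _ hc' _ hd' o4 (by rw [hπ]; order) (by rwa [hπ, hπ])
            rw [hπ] at n2
            refine finish hd' fun z hz => ?_
            rcases wide _ _ (by order) (by order) (by order) (by order) n2 hc' (mm' d hd') z hz
              with g | g
            · exact Or.inl ⟨g.1, by order, by order⟩
            · exact Or.inr ⟨g.1, g.2, by order⟩
          · have := inj _ _ h4.symm
            order
          · exact outer o4 h3 h4
        · have := inj _ _ h3
          order
        · have hd' : π d ∉ E := fun hd' => gab _ hd' ⟨h3, by order⟩
          have n1 := hN a ha _ hd' h3 o5 (by rw [hπ]; order)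
          rw [hπ] at n1
          refine finish hd' fun z hz => ?_
          rcases out z hz with g | g
          · exact Or.inl ⟨g, by order, by order⟩
          · refine Or.inr ⟨g, ?_, by order⟩
            rcases lt_trichotomy d z with g3 | g3 | g3
            · exact g3
            · exact absurd (g3 ▸ hz) (mm' d hd')
            · exact absurd ⟨by order, g3⟩ (n1 z hz)
    · have h2 := inj _ _ h1
      refine finish (h1 ▸ hb) fun z hz => ?_
      rcases out z hz with g | g
      · exact Or.inl ⟨g, by order, by order⟩
      · exact Or.inr ⟨g, by order, by order⟩
    · have hd' : π d ∉ E := fun hd' => gab _ hd' ⟨by order, by order⟩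
      refine finish hd' fun z hz => ?_
      rcases out z hz with g | g
      · exact Or.inl ⟨g, by order, by order⟩
      · refine Or.inr ⟨g, ?_, by order⟩
        rcases lt_trichotomy d (π b) with h2 | h2 | h2
        · order
        · order
        · have n1 := hN b hb _ hd' h1 (by order) (by rwa [hπ])
          rw [hπ] at n1
          rcases lt_trichotomy d z with g3 | g3 | g3
          · exact g3
          · exact absurd (g3 ▸ hz) (mm' d hd')
          · exact absurd ⟨by order, g3⟩ (n1 z hz)
  rcases key z hz with h' | h'
  · exact Or.inl ⟨h'.1, h'.2.2.2⟩
  · exact Or.inr ⟨h'.2.1, h'.1⟩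

/-- An occurrence of `3412` lies in the core or in a single diagonal cell. -/
theorem Tame.occ_core_or_gap (h : Tame π E) (hπ : ∀ x, π (π x) = x) (hE : ∀ x ∈ E, π x ∈ E)
    (hc : Conn π E) {o : α} (ho : o ∈ E) (hbot : ∀ x, o ≤ x) {a b c d : α}
    (hO : Is3412 π a b c d) : (a ∈ E ∧ b ∈ E ∧ c ∈ E ∧ d ∈ E) ∨
      ∀ z ∈ E, (z < a ∧ z < π c) ∨ (d < z ∧ π b < z) := by
  have main : ∀ a b c d, Is3412 π a b c d → b < π a → (a ∈ E ∧ b ∈ E ∧ c ∈ E ∧ d ∈ E) ∨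
      ∀ z ∈ E, (z < a ∧ z < π c) ∨ (d < z ∧ π b < z) := by
    intro a b c d hO hab
    by_cases ha : a ∈ E
    · have hb : b ∈ E := by
        by_contra hb
        exact h.cross_left a ha b hb hO.1 hab hO.2.2.2.2.2
      exact Or.inl ⟨ha, hb, h.core_below hπ hE hc ho hbot hO hab ha hb⟩
    · have hb : b ∉ E := fun hb =>
        h.cross_right b hb a ha hO.1 hab hO.2.2.2.2.2
      exact Or.inr fun z hz => h.gap_below hπ hE hc ho hbot hO hab ha hb hz
  -- Either the arcs of the first two entries cross, or `π d < π a ≤ b < c` makes the first two arcs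
  -- of the mirrored occurrence cross.
  by_cases hab : b < π a
  · exact main a b c d hO hab
  · have hm := hO.mirror hπ
    have hcd : π d < π (π c) := by
      rw [hπ]
      obtain ⟨o1, o2, o3, o4, o5, o6⟩ := hO
      order
    rcases main _ _ _ _ hm hcd with g | g
    · have := hE _ g.1
      have := hE _ g.2.1
      have := hE _ g.2.2.1
      have := hE _ g.2.2.2
      simp only [hπ] at *
      tauto
    · refine Or.inr fun z hz => ?_
      have := g z hz
      simp only [hπ] at this
      tauto

end Generic

/-! ### Existence, uniqueness and size of the kernel -/

section Generic

variable {α : Type*} [LinearOrder α] {π : α → α} {E : Set α}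

/-- The occurrences of `3412` in `π` all of whose entries lie in `E`, as quadruples of positions. -/
def occIn (π : α → α) (E : Set α) : Set (α × α × α × α) :=
  {q | Is3412 π q.1 q.2.1 q.2.2.1 q.2.2.2 ∧ q.1 ∈ E ∧ q.2.1 ∈ E ∧ q.2.2.1 ∈ E ∧ q.2.2.2 ∈ E}

/-- The properties that characterize the kernel of an involution `π`. -/
structure KerSet (π : α → α) (E : Set α) : Prop where
  bot : ∃ o ∈ E, ∀ x, o ≤ x
  closed : ∀ x ∈ E, π x ∈ E
  conn : Conn π E
  sat : ∀ a b c d, Is3412 π a b c d → a ∈ E ∨ b ∈ E ∨ c ∈ E ∨ d ∈ E →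
    a ∈ E ∧ b ∈ E ∧ c ∈ E ∧ d ∈ E

/-- At least two of four propositions hold. -/
def TwoOf (p q r s : Prop) : Prop := (p ∧ q) ∨ (p ∧ r) ∨ (p ∧ s) ∨ (q ∧ r) ∨ (q ∧ s) ∨ (r ∧ s)

theorem TwoOf.mono {p q r s p' q' r' s' : Prop} (hp : p → p') (hq : q → q') (hr : r → r')
    (hs : s → s') (h : TwoOf p q r s) : TwoOf p' q' r' s' :=
  h.imp (And.imp hp hq) <| Or.imp (And.imp hp hr) <| Or.imp (And.imp hp hs) <|
    Or.imp (And.imp hq hr) <| Or.imp (And.imp hq hs) (And.imp hr hs)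

theorem TwoOf.any {p q r s : Prop} (h : TwoOf p q r s) : p ∨ q ∨ r ∨ s := by
  unfold TwoOf at h; tauto

theorem TwoOf.mirror {p q r s : Prop} (h : TwoOf p q r s) : TwoOf r s p q := by
  unfold TwoOf at *; tauto

/-- Every condition of `Tame` concerns an occurrence with at least two core entries: crossing arcs
form an occurrence containing both ends of the core arc. -/
theorem tame_of_two (hπ : ∀ x, π (π x) = x) (hE : ∀ x ∈ E, π x ∈ E)
    (h : ∀ a b c d, Is3412 π a b c d → TwoOf (a ∈ E) (b ∈ E) (c ∈ E) (d ∈ E) →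
      a ∈ E ∧ b ∈ E ∧ c ∈ E ∧ d ∈ E) : Tame π E := by
  constructor
  · intro a b c d ho hb hc hd
    exact (h a b c d ho (by unfold TwoOf; tauto)).1
  · intro a b c d ho hb hc hd
    exact (h a b c d ho (by unfold TwoOf; tauto)).2.1
  · intro x hx p hp h1 h2 h3
    exact hp (h _ _ _ _ (is3412_of_cross hπ h1 h2 h3) (Or.inr (Or.inl ⟨hx, hE x hx⟩))).2.1
  · intro x hx p hp h1 h2 h3
    exact hp (h _ _ _ _ (is3412_of_cross hπ h1 h2 h3) (by have := hE x hx; unfold TwoOf; tauto)).1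
  · intro a b c d ho ha hb hc
    exact absurd (h a b c d ho (Or.inl ⟨ha, hb⟩)).2.2.1 hc

theorem KerSet.tame (h : KerSet π E) (hπ : ∀ x, π (π x) = x) : Tame π E :=
  tame_of_two hπ h.closed fun a b c d ho hh => h.sat a b c d ho hh.any

/-- The gain is from two core entries to one: an occurrence not in the core lies within a gap and so
meets no core entry at all. -/
theorem Tame.sat (h : Tame π E) (hπ : ∀ x, π (π x) = x) (hE : ∀ x ∈ E, π x ∈ E)
    (hc : Conn π E) {o : α} (ho : o ∈ E) (hbot : ∀ x, o ≤ x) : KerSet π E := by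
  refine ⟨⟨o, ho, hbot⟩, hE, hc, fun a b c d hO hm => ?_⟩
  rcases h.occ_core_or_gap hπ hE hc ho hbot hO with g | g
  · exact g
  · exfalso
    obtain ⟨o1, o2, o3, o4, o5, o6⟩ := hO
    rcases hm with hm | hm | hm | hm <;> rcases g _ hm with g | g <;> have := g.1 <;> order

/-- The intersection is closed and contains the least position. Were it proper in `E`, connectivity
would give an occurrence in `E` that meets `E'` without lying in it. -/
theorem KerSet.subset {E' : Set α} (h : KerSet π E) (h' : KerSet π E') : E ⊆ E' := by
  obtain ⟨o, ho, hbot⟩ := h.bot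
  obtain ⟨o', ho', hbot'⟩ := h'.bot
  have hoo : o = o' := le_antisymm (hbot _) (hbot' _)
  subst hoo
  by_contra hne
  obtain ⟨a, b, c, d, hO, ha, hb, hc, hd, h1, h2⟩ := h.conn (E ∩ E') Set.inter_subset_left
    (fun x hx => ⟨h.closed x hx.1, h'.closed x hx.2⟩) ⟨o, ho, ho'⟩
    (fun he => hne (Set.inter_eq_left.1 he))
  have := h'.sat a b c d hO (by
    rcases h1 with h1 | h1 | h1 | h1 <;> have := h1.2 <;> tauto)
  exact h2 ⟨⟨ha, this.1⟩, ⟨hb, this.2.1⟩, ⟨hc, this.2.2.1⟩, ⟨hd, this.2.2.2⟩⟩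

theorem KerSet.unique {E' : Set α} (h : KerSet π E) (h' : KerSet π E') : E = E' :=
  (h.subset h').antisymm (h'.subset h)

/-- A closed subset `A` of `E'` splits `E`, contains it or misses it. In the last two cases the
added occurrence itself crosses `A`, since all new entries are its entries or their images. -/
theorem Conn.extend (hπ : ∀ x, π (π x) = x) (hE : ∀ x ∈ E, π x ∈ E) (hconn : Conn π E)
    {E' : Set α} (hsub : E ⊆ E') {a b c d : α} (hO : Is3412 π a b c d)
    (ha : a ∈ E') (hb : b ∈ E') (hc : c ∈ E') (hd : d ∈ E')
    (hany : a ∈ E ∨ b ∈ E ∨ c ∈ E ∨ d ∈ E)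
    (hcov : ∀ x ∈ E', x ∈ E ∨ (x = a ∨ x = b ∨ x = c ∨ x = d) ∨
      (x = π a ∨ x = π b ∨ x = π c ∨ x = π d)) : Conn π E' := by
  intro A hA hcl hne hne'
  have clb : ∀ x, π x ∈ A → x ∈ A := fun x hx => by have := hcl _ hx; rwa [hπ] at this
  by_cases h1 : (A ∩ E).Nonempty
  · by_cases h2 : A ∩ E = E
    · have h2 : E ⊆ A := Set.inter_eq_right.1 h2
      refine ⟨a, b, c, d, hO, ha, hb, hc, hd,
        hany.imp (@h2 _) (Or.imp (@h2 _) (Or.imp (@h2 _) (@h2 _))), ?_⟩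
      rintro ⟨ha, hb, hc, hd⟩
      apply hne'
      apply hA.antisymm
      intro x hx
      rcases hcov x hx with hx | hx
      · exact h2 hx
      · rcases hx with (rfl | rfl | rfl | rfl) | (rfl | rfl | rfl | rfl) <;>
          first | assumption | (apply hcl; assumption)
    · obtain ⟨a', b', c', d', hO', ha, hb, hc, hd, g1, g2⟩ := hconn (A ∩ E)
        Set.inter_subset_right (fun x hx => ⟨hcl x hx.1, hE x hx.2⟩) h1 h2
      refine ⟨a', b', c', d', hO', hsub ha, hsub hb, hsub hc, hsub hd,
        g1.imp And.left (Or.imp And.left (Or.imp And.left And.left)), ?_⟩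
      rintro ⟨g1, g2', g3, g4⟩
      exact g2 ⟨⟨g1, ha⟩, ⟨g2', hb⟩, ⟨g3, hc⟩, ⟨g4, hd⟩⟩
  · have h1 : ∀ x ∈ A, x ∉ E := fun x hx hx' => h1 ⟨x, hx, hx'⟩
    refine ⟨a, b, c, d, hO, ha, hb, hc, hd, ?_, ?_⟩
    · obtain ⟨x, hx⟩ := hne
      rcases (hcov x (hA hx)).resolve_left (h1 x hx) with
        (rfl | rfl | rfl | rfl) | (rfl | rfl | rfl | rfl)
      · exact Or.inl hx
      · exact Or.inr (Or.inl hx)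
      · exact Or.inr (Or.inr (Or.inl hx))
      · exact Or.inr (Or.inr (Or.inr hx))
      · exact Or.inl (clb _ hx)
      · exact Or.inr (Or.inl (clb _ hx))
      · exact Or.inr (Or.inr (Or.inl (clb _ hx)))
      · exact Or.inr (Or.inr (Or.inr (clb _ hx)))
    · rintro ⟨ha, hb, hc, hd⟩
      rcases hany with h | h | h | h
      · exact h1 _ ha h
      · exact h1 _ hb h
      · exact h1 _ hc h
      · exact h1 _ hd h

theorem TwoOf.exists_cover {β : Type*} {E : Set β} {a b c d : β} (h : TwoOf (a ∈ E) (b ∈ E) (c ∈ E) (d ∈ E)) :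
    ∃ u v, ∀ x, x = a ∨ x = b ∨ x = c ∨ x = d → x ∈ E ∨ x = u ∨ x = v := by
  rcases h with h | h | h | h | h | h
  · exact ⟨c, d, by rintro x (rfl | rfl | rfl | rfl) <;> tauto⟩
  · exact ⟨b, d, by rintro x (rfl | rfl | rfl | rfl) <;> tauto⟩
  · exact ⟨b, c, by rintro x (rfl | rfl | rfl | rfl) <;> tauto⟩
  · exact ⟨a, d, by rintro x (rfl | rfl | rfl | rfl) <;> tauto⟩
  · exact ⟨a, c, by rintro x (rfl | rfl | rfl | rfl) <;> tauto⟩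
  · exact ⟨a, b, by rintro x (rfl | rfl | rfl | rfl) <;> tauto⟩

/-- Every involution has a kernel, of size at most `2c + 2` where `c` is its capacity. -/
theorem exists_kerSet [Finite α] (hπ : ∀ x, π (π x) = x) {o : α} (hbot : ∀ x, o ≤ x) {S : Set α}
    (hoS : o ∈ S) (hoS' : π o ∈ S)
    (hS : ∀ a b c d, Is3412 π a b c d → TwoOf (a ∈ S) (b ∈ S) (c ∈ S) (d ∈ S) →
      a ∈ S ∧ b ∈ S ∧ c ∈ S ∧ d ∈ S) :
    ∃ E, KerSet π E ∧ E ⊆ S ∧ E.ncard ≤ 2 * (occIn π E).ncard + 2 := by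
  let Pre : Set α → Prop := fun E => o ∈ E ∧ (∀ x ∈ E, π x ∈ E) ∧ Conn π E ∧ E ⊆ S ∧
    E.ncard ≤ 2 * (occIn π E).ncard + 2
  have hpre : Pre {o, π o} := by
    refine ⟨by simp, ?_, ?_, ?_, ?_⟩
    · rintro x (rfl | rfl) <;> simp [hπ]
    · intro A hA hcl hne hne'
      exfalso
      apply hne'
      apply hA.antisymm
      have : o ∈ A ∧ π o ∈ A := by
        obtain ⟨x, hx⟩ := hne
        rcases hA hx with rfl | rfl
        · exact ⟨hx, hcl _ hx⟩
        · refine ⟨?_, hx⟩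
          have := hcl _ hx
          rwa [hπ] at this
      rintro x (rfl | rfl)
      · exact this.1
      · exact this.2
    · rintro x (rfl | rfl)
      · exact hoS
      · exact hoS'
    · exact (Set.ncard_insert_le _ _).trans (by rw [Set.ncard_singleton]; omega)
  obtain ⟨E, hEmax⟩ := (Set.toFinite {E | Pre E}).exists_maximal ⟨_, hpre⟩
  obtain ⟨hoE, hE, hconn, hES, hcard⟩ := hEmax.prop
  refine ⟨E, ?_, hES, hcard⟩
  -- By maximality only occurrences with two entries in `E` have to be absorbed; those with a single
  -- one are handled by `Tame.sat`.
  refine Tame.sat (tame_of_two hπ hE ?_) hπ hE hconn hoE hbot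
  intro a b c d hO htwo
  by_contra hnot
  let N : Set α := {x | (x = a ∨ x = b ∨ x = c ∨ x = d) ∨ (x = π a ∨ x = π b ∨ x = π c ∨ x = π d)}
  have hm := hO.mirror hπ
  have hall := hS a b c d hO (htwo.mono (@hES _) (@hES _) (@hES _) (@hES _))
  have hall' := hS _ _ _ _ hm (htwo.mirror.mono (fun h => hES (hE _ h)) (fun h => hES (hE _ h))
    (fun h => hES (hE _ h)) (fun h => hES (hE _ h)))
  have back : ∀ x, π x ∈ E → x ∈ E := fun x hx => by have := hE _ hx; rwa [hπ] at this
  have hq : (a, b, c, d) ∉ occIn π E := fun h => hnot h.2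
  have hq' : (π c, π d, π a, π b) ∉ occIn π E := fun h => hnot
    ⟨back _ h.2.2.2.1, back _ h.2.2.2.2, back _ h.2.1, back _ h.2.2.1⟩
  have hsub : occIn π E ⊆ occIn π (E ∪ N) := fun q h =>
    ⟨h.1, Or.inl h.2.1, Or.inl h.2.2.1, Or.inl h.2.2.2.1, Or.inl h.2.2.2.2⟩
  have hqm : (a, b, c, d) ∈ occIn π (E ∪ N) := by
    refine ⟨hO, ?_, ?_, ?_, ?_⟩ <;> right <;> simp [N]
  have hqm' : (π c, π d, π a, π b) ∈ occIn π (E ∪ N) := by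
    refine ⟨hm, ?_, ?_, ?_, ?_⟩ <;> right <;> simp [N]
  obtain ⟨u, v, huv⟩ := htwo.exists_cover
  have hbig : Pre (E ∪ N) := by
    refine ⟨Or.inl hoE, ?_, ?_, ?_, ?_⟩
    · rintro x (hx | hx)
      · exact Or.inl (hE x hx)
      · right
        rcases hx with (rfl | rfl | rfl | rfl) | (rfl | rfl | rfl | rfl) <;> simp [N, hπ]
    · exact hconn.extend hπ hE Set.subset_union_left hO hqm.2.1 hqm.2.2.1 hqm.2.2.2.1
        hqm.2.2.2.2 htwo.any fun x hx => hx
    · rintro x (hx | hx)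
      · exact hES hx
      · obtain ⟨g1, g2, g3, g4⟩ := hall
        obtain ⟨g5, g6, g7, g8⟩ := hall'
        rcases hx with (rfl | rfl | rfl | rfl) | (rfl | rfl | rfl | rfl) <;> assumption
    · have hfin : (occIn π (E ∪ N)).Finite := Set.toFinite _
      by_cases heq : (π c, π d, π a, π b) = (a, b, c, d)
      · have h1 : (insert (a, b, c, d) (occIn π E)).ncard ≤ (occIn π (E ∪ N)).ncard :=
          Set.ncard_le_ncard (Set.insert_subset hqm hsub) hfin
        rw [Set.ncard_insert_of_notMem hq (Set.toFinite _)] at h1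
        have h2 : E ∪ N ⊆ E ∪ {u, v} := by
          rintro x (hx | hx)
          · exact Or.inl hx
          · simp only [Prod.mk.injEq] at heq
            obtain ⟨e1, e2, e3, e4⟩ := heq
            apply huv
            rcases hx with hx | hx
            · exact hx
            · rw [e1, e2, e3, e4] at hx
              exact hx.elim (fun h => Or.inr (Or.inr (Or.inl h))) (Or.elim · (fun h => Or.inr (Or.inr (Or.inr h)))
                (Or.elim · Or.inl (fun h => Or.inr (Or.inl h))))
        have h3 := (Set.ncard_le_ncard h2 (Set.toFinite _)).trans (Set.ncard_union_le _ _)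
        have h4 := Set.ncard_insert_le u {v}
        rw [Set.ncard_singleton] at h4
        omega
      · have h1 : (insert (π c, π d, π a, π b) (insert (a, b, c, d) (occIn π E))).ncard ≤
            (occIn π (E ∪ N)).ncard :=
          Set.ncard_le_ncard (Set.insert_subset hqm' (Set.insert_subset hqm hsub)) hfin
        rw [Set.ncard_insert_of_notMem (by
            rintro (h | h)
            · exact heq h
            · exact hq' h) (Set.toFinite _),
          Set.ncard_insert_of_notMem hq (Set.toFinite _)] at h1
        have h2 : E ∪ N ⊆ E ∪ {u, v, π u, π v} := by
          rintro x (hx | hx)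
          · exact Or.inl hx
          · rcases hx with hx | hx
            · rcases huv x hx with h | rfl | rfl <;> simp [*]
            · have hx' : π x = a ∨ π x = b ∨ π x = c ∨ π x = d := by
                rcases hx with rfl | rfl | rfl | rfl <;> simp [hπ]
              rcases huv _ hx' with h | h | h
              · exact Or.inl (back _ h)
              · rw [← hπ x, h]; simp
              · rw [← hπ x, h]; simp
        have h3 := (Set.ncard_le_ncard h2 (Set.toFinite _)).trans (Set.ncard_union_le _ _)
        have h4 := Set.ncard_insert_le u {v, π u, π v}
        have h5 := Set.ncard_insert_le v {π u, π v}
        have h6 := Set.ncard_insert_le (π u) {π v}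
        rw [Set.ncard_singleton] at h6
        omega
  have hle := hEmax.2 hbig Set.subset_union_left
  exact hnot ⟨hle hqm.2.1, hle hqm.2.2.1, hle hqm.2.2.2.1, hle hqm.2.2.2.2⟩

end Generic

theorem IsInvolution.apply_apply {n : ℕ} {π : Equiv.Perm (Fin n)} (h : IsInvolution π) (x : Fin n) :
    π (π x) = x := by
  nth_rewrite 1 [← h]
  simp

theorem isInvolution_iff {n : ℕ} {π : Equiv.Perm (Fin n)} :
    IsInvolution π ↔ ∀ x, π (π x) = x :=
  ⟨fun h => h.apply_apply, fun h => by
    ext x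
    rw [Equiv.Perm.inv_eq_iff_eq.2 (h x).symm]⟩

/-! ### Occurrences as quadruples, and their transport along embeddings -/

section Occurrences

variable {n : ℕ} {π : Equiv.Perm (Fin n)}

theorem Occ.is3412 (o : Occ π) : Is3412 π (o.1 0) (o.1 1) (o.1 2) (o.1 3) := by
  refine ⟨o.1.strictMono (by decide), o.1.strictMono (by decide), o.1.strictMono (by decide),
    (o.2 _ _).2 (by decide), (o.2 _ _).2 (by decide), (o.2 _ _).2 (by decide)⟩

/-- The occurrence given by four positions. -/
def Occ.mk {a b c d : Fin n} (h : Is3412 π a b c d) : Occ π :=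
  ⟨OrderEmbedding.ofStrictMono ![a, b, c, d] (by
    obtain ⟨o1, o2, o3, o4, o5, o6⟩ := h
    rw [Fin.strictMono_iff_lt_succ]
    intro i
    fin_cases i
    · exact o1
    · exact o2
    · exact o3), by
    obtain ⟨o1, o2, o3, o4, o5, o6⟩ := h
    have hm : StrictMono fun k : Fin 4 => π (![a, b, c, d] (p3412 k)) := by
      rw [Fin.strictMono_iff_lt_succ]
      intro i
      fin_cases i
      · exact o4
      · exact o5
      · exact o6
    intro x y
    have hp : ∀ x, p3412 (p3412 x) = x := by decide
    have := hm.lt_iff_lt (a := p3412 x) (b := p3412 y)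
    simp only [hp] at this
    exact this⟩

theorem Occ.mk_contains {a b c d : Fin n} (h : Is3412 π a b c d) (i : Fin n) :
    (Occ.mk h).Contains i ↔ i = a ∨ i = b ∨ i = c ∨ i = d := by
  constructor
  · rintro ⟨k, rfl⟩
    fin_cases k
    · exact Or.inl rfl
    · exact Or.inr (Or.inl rfl)
    · exact Or.inr (Or.inr (Or.inl rfl))
    · exact Or.inr (Or.inr (Or.inr rfl))
  · rintro (rfl | rfl | rfl | rfl)
    · exact ⟨0, rfl⟩
    · exact ⟨1, rfl⟩
    · exact ⟨2, rfl⟩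
    · exact ⟨3, rfl⟩

theorem Occ.contains_iff (o : Occ π) (i : Fin n) :
    o.Contains i ↔ i = o.1 0 ∨ i = o.1 1 ∨ i = o.1 2 ∨ i = o.1 3 := by
  constructor
  · rintro ⟨k, rfl⟩
    fin_cases k
    · exact Or.inl rfl
    · exact Or.inr (Or.inl rfl)
    · exact Or.inr (Or.inr (Or.inl rfl))
    · exact Or.inr (Or.inr (Or.inr rfl))
  · rintro (rfl | rfl | rfl | rfl)
    · exact ⟨0, rfl⟩
    · exact ⟨1, rfl⟩
    · exact ⟨2, rfl⟩
    · exact ⟨3, rfl⟩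

theorem numOcc_eq_ncard : numOcc π = (occIn (π : Fin n → Fin n) Set.univ).ncard := by
  rw [← Nat.card_coe_set_eq]
  refine Nat.card_congr
    { toFun := fun o => ⟨(o.1 0, o.1 1, o.1 2, o.1 3), o.is3412, trivial, trivial, trivial, trivial⟩
      invFun := fun q => Occ.mk q.2.1
      left_inv := ?_
      right_inv := ?_ }
  · intro o
    apply Subtype.ext
    apply RelEmbedding.ext
    intro k
    fin_cases k <;> rfl
  · rintro ⟨⟨a, b, c, d⟩, h⟩
    rfl

end Occurrences

section Transport

variable {α β : Type*} [LinearOrder α] [LinearOrder β] {π : α → α} {ρ : β → β} {e : β → α}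

theorem is3412_map_iff (he : StrictMono e) (hπ : ∀ k, π (e k) = e (ρ k)) {a b c d : β} :
    Is3412 π (e a) (e b) (e c) (e d) ↔ Is3412 ρ a b c d := by
  simp only [Is3412, hπ, he.lt_iff_lt]

theorem conn_range_iff (he : StrictMono e) (hπ : ∀ k, π (e k) = e (ρ k)) :
    Conn π (Set.range e) ↔ Conn ρ Set.univ := by
  constructor
  · intro h A _ hcl hne hne'
    obtain ⟨_, _, _, _, hO, ⟨a, rfl⟩, ⟨b, rfl⟩, ⟨c, rfl⟩, ⟨d, rfl⟩, h1, h2⟩ := h (e '' A)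
      (Set.image_subset_range _ _) (by
        rintro _ ⟨x, hx, rfl⟩
        exact ⟨ρ x, hcl x hx, (hπ x).symm⟩) (hne.image _) (by
        rw [← Set.image_univ]
        exact fun h' => hne' (he.injective.image_injective h'))
    simp only [he.injective.mem_set_image] at h1 h2
    exact ⟨a, b, c, d, (is3412_map_iff he hπ).1 hO, trivial, trivial, trivial, trivial, h1, h2⟩
  · intro h A hA hcl hne hne'
    obtain ⟨a, b, c, d, hO, -, -, -, -, h1, h2⟩ := h (e ⁻¹' A) (Set.subset_univ _) (by
        intro x hx
        have := hcl _ hx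
        rwa [hπ] at this) (by
        obtain ⟨x, hx⟩ := hne
        obtain ⟨y, rfl⟩ := hA hx
        exact ⟨y, hx⟩) (by
        intro h'
        apply hne'
        apply hA.antisymm
        rintro _ ⟨x, rfl⟩
        have : x ∈ e ⁻¹' A := h' ▸ Set.mem_univ x
        exact this)
    exact ⟨e a, e b, e c, e d, (is3412_map_iff he hπ).2 hO, ⟨a, rfl⟩, ⟨b, rfl⟩, ⟨c, rfl⟩, ⟨d, rfl⟩,
      h1, h2⟩

/-- The occurrences inside the image of an embedding correspond to those of the pattern. -/
theorem ncard_occIn_range (he : StrictMono e) (hπ : ∀ k, π (e k) = e (ρ k)) :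
    (occIn π (Set.range e)).ncard = (occIn ρ Set.univ).ncard := by
  have himg : occIn π (Set.range e) =
      (fun q : β × β × β × β => (e q.1, e q.2.1, e q.2.2.1, e q.2.2.2)) '' occIn ρ Set.univ := by
    ext ⟨a, b, c, d⟩
    constructor
    · rintro ⟨hO, ⟨a, rfl⟩, ⟨b, rfl⟩, ⟨c, rfl⟩, ⟨d, rfl⟩⟩
      exact ⟨(a, b, c, d), ⟨(is3412_map_iff he hπ).1 hO, trivial, trivial, trivial, trivial⟩, rfl⟩
    · rintro ⟨⟨a, b, c, d⟩, ⟨hO, -⟩, h⟩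
      simp only [Prod.mk.injEq] at h
      obtain ⟨rfl, rfl, rfl, rfl⟩ := h
      exact ⟨(is3412_map_iff he hπ).2 hO, ⟨a, rfl⟩, ⟨b, rfl⟩, ⟨c, rfl⟩, ⟨d, rfl⟩⟩
  rw [himg, Set.ncard_image_of_injective]
  rintro ⟨a, b, c, d⟩ ⟨a', b', c', d'⟩ h
  simp only [Prod.mk.injEq, he.injective.eq_iff] at h
  simp [h]

end Transport

/-! ### The kernel defined by the graph, and kernel shapes -/

section Kernel

variable {n : ℕ} {π : Equiv.Perm (Fin n)}

theorem occGraph_adj {i : Fin n} {o : Occ π} : (occGraph π).Adj (Sum.inl i) (Sum.inr o) ↔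
    o.Contains i := by
  unfold occGraph
  rw [SimpleGraph.fromRel_adj]
  constructor
  · rintro ⟨-, ⟨i', o', h1, h2, h3⟩ | ⟨i', o', h1, h2, h3⟩⟩
    · cases h1; cases h2; exact h3
    · cases h1
  · intro h
    exact ⟨by simp, Or.inl ⟨i, o, rfl, rfl, h⟩⟩

theorem occGraph_reachable {a b c d : Fin n} (h : Is3412 π a b c d) {i j : Fin n}
    (hi : i = a ∨ i = b ∨ i = c ∨ i = d) (hj : j = a ∨ j = b ∨ j = c ∨ j = d) :
    (occGraph π).Reachable (Sum.inl i) (Sum.inl j) := by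
  have h1 : (occGraph π).Adj (Sum.inl i) (Sum.inr (Occ.mk h)) :=
    occGraph_adj.2 ((Occ.mk_contains h i).2 hi)
  have h2 : (occGraph π).Adj (Sum.inl j) (Sum.inr (Occ.mk h)) :=
    occGraph_adj.2 ((Occ.mk_contains h j).2 hj)
  exact h1.reachable.trans h2.symm.reachable

/-- Saturation carries membership in `E` along every edge of the graph, starting from the image of
the least position. -/
theorem kernelSet_subset (hinv : IsInvolution π) {E : Set (Fin n)} (hE : KerSet π E) :
    kernelSet π ⊆ E := by
  obtain ⟨o, ho, hbot⟩ := hE.bot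
  rintro i ⟨z, hz, h⟩
  have hzo : z = o := le_antisymm (by rw [Fin.le_def, hz]; exact Nat.zero_le _) (hbot z)
  subst hzo
  rcases h with rfl | h
  · exact ho
  · let P : Fin n ⊕ Occ π → Prop := fun v => match v with
      | Sum.inl i => i ∈ E
      | Sum.inr o => ∀ i, o.Contains i → i ∈ E
    have step : ∀ v w, (occGraph π).Adj v w → P v → P w := by
      intro v w hvw hv
      have key : ∀ (i : Fin n) (o : Occ π), o.Contains i → i ∈ E → ∀ j, o.Contains j → j ∈ E := by
        intro i o hi hiE j hj
        rw [Occ.contains_iff] at hi hj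
        have := hE.sat _ _ _ _ o.is3412 (by rcases hi with rfl | rfl | rfl | rfl <;> tauto)
        rcases hj with rfl | rfl | rfl | rfl
        · exact this.1
        · exact this.2.1
        · exact this.2.2.1
        · exact this.2.2.2
      unfold occGraph at hvw
      rw [SimpleGraph.fromRel_adj] at hvw
      rcases hvw with ⟨-, ⟨i', o', rfl, rfl, h3⟩ | ⟨i', o', rfl, rfl, h3⟩⟩
      · exact key i' o' h3 hv
      · exact hv i' h3
    have walk : ∀ v w (p : (occGraph π).Walk v w), P v → P w := by
      intro v w p
      induction p with
      | nil => exact id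
      | cons h p ih => exact fun hv => ih (step _ _ h hv)
    obtain ⟨w⟩ := h
    refine walk _ _ w ?_
    have := hE.closed z ho
    rw [show π⁻¹ = π from hinv]
    exact this

theorem mem_kernelSet_iff (hinv : IsInvolution π) {z : Fin n} (hz : z.val = 0) (i : Fin n) :
    i ∈ kernelSet π ↔ i = z ∨ (occGraph π).Reachable (Sum.inl (π z)) (Sum.inl i) := by
  have hp : π⁻¹ = π := hinv
  unfold kernelSet
  rw [Set.mem_ofPred_eq, hp]
  constructor
  · rintro ⟨z', hz', h⟩
    have : z' = z := Fin.ext (by omega)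
    rwa [this] at h
  · exact fun h => ⟨z, hz, h⟩

/-- The kernel of an involution, characterized without reference to the graph. -/
theorem kerSet_kernelSet (hinv : IsInvolution π) (hn : 0 < n) :
    KerSet π (kernelSet π) ∧
      (kernelSet π).ncard ≤ 2 * (occIn π (kernelSet π)).ncard + 2 := by
  let z : Fin n := ⟨0, hn⟩
  have hbot : ∀ x, z ≤ x := fun x => by rw [Fin.le_def]; exact Nat.zero_le _
  have hmem := mem_kernelSet_iff hinv (z := z) rfl
  have hS : ∀ a b c d, Is3412 π a b c d →
      TwoOf (a ∈ kernelSet π) (b ∈ kernelSet π) (c ∈ kernelSet π) (d ∈ kernelSet π) →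
      a ∈ kernelSet π ∧ b ∈ kernelSet π ∧ c ∈ kernelSet π ∧ d ∈ kernelSet π := by
    intro a b c d hO h
    have reach : ∀ i j, (i = a ∨ i = b ∨ i = c ∨ i = d) → i ≠ z → i ∈ kernelSet π →
        (j = a ∨ j = b ∨ j = c ∨ j = d) → j ∈ kernelSet π := by
      intro i j hi hiz hi' hj
      rw [hmem] at hi' ⊢
      exact Or.inr ((hi'.resolve_left hiz).trans (occGraph_reachable hO hi hj))
    -- The position `z` belongs to the kernel by definition and perhaps not to the component. As the
    -- least position it can only be the first entry of an occurrence, so one of two kernel entries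
    -- is in the component.
    have hex : ∃ i, (i = a ∨ i = b ∨ i = c ∨ i = d) ∧ i ≠ z ∧ i ∈ kernelSet π := by
      obtain ⟨o1, o2, o3, -⟩ := hO
      have hb : b ≠ z := fun h => absurd (hbot a) (not_le.2 (h ▸ o1))
      have hc : c ≠ z := fun h => absurd (hbot b) (not_le.2 (h ▸ o2))
      have hd : d ≠ z := fun h => absurd (hbot c) (not_le.2 (h ▸ o3))
      rcases h with h | h | h | h | h | h
      · exact ⟨b, by simp, hb, h.2⟩
      · exact ⟨c, by simp, hc, h.2⟩
      · exact ⟨d, by simp, hd, h.2⟩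
      · exact ⟨c, by simp, hc, h.2⟩
      · exact ⟨d, by simp, hd, h.2⟩
      · exact ⟨d, by simp, hd, h.2⟩
    obtain ⟨i, h1, h2, h3⟩ := hex
    exact ⟨reach i a h1 h2 h3 (by simp), reach i b h1 h2 h3 (by simp),
      reach i c h1 h2 h3 (by simp), reach i d h1 h2 h3 (by simp)⟩
  obtain ⟨E, hE, hES, hcard⟩ := exists_kerSet (π := π) hinv.apply_apply hbot
    ((hmem z).2 (Or.inl rfl)) ((hmem (π z)).2 (Or.inr (SimpleGraph.Reachable.refl _))) hS
  have : E = kernelSet π := hES.antisymm (kernelSet_subset hinv hE)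
  rw [← this]
  exact ⟨hE, hcard⟩

theorem KerSet.eq_kernelSet (hinv : IsInvolution π) {E : Set (Fin n)} (h : KerSet π E) :
    E = kernelSet π := by
  obtain ⟨o, -⟩ := h.bot
  exact h.unique (kerSet_kernelSet hinv o.pos).1

/-- Two permutations with the same relative order are equal. -/
theorem perm_eq_of_lt_iff {s : ℕ} {σ τ : Equiv.Perm (Fin s)}
    (h : ∀ k l, σ k < σ l ↔ τ k < τ l) : σ = τ := by
  have h1 : StrictMono (fun k => σ (τ⁻¹ k)) := fun k l hkl => by
    rw [h]; simpa using hkl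
  have h2 : (fun k => σ (τ⁻¹ k)) = id := by
    refine (StrictMono.range_inj h1 strictMono_id).1 ?_
    rw [Set.range_id]
    exact Set.range_eq_univ.2 (σ.surjective.comp (τ⁻¹).surjective)
  ext k
  have := congrFun h2 (τ k)
  simp at this
  rw [this]

/-- The kernel is closed under `π`, so being order-isomorphic to `ρ` amounts to `π` permuting the
kernel positions as `ρ` permutes their indices. -/
theorem isKernel_iff (hinv : IsInvolution π) (hn : 0 < n) {s : ℕ} {ρ : Equiv.Perm (Fin s)}
    {e : Fin s ↪o Fin n} :
    IsKernel ρ π e ↔ KerSet π (Set.range e) ∧ ∀ k, π (e k) = e (ρ k) := by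
  constructor
  · rintro ⟨h1, h2⟩
    have hK := (kerSet_kernelSet hinv hn).1
    rw [← h1] at hK
    refine ⟨hK, ?_⟩
    have hex : ∀ k, ∃ l, e l = π (e k) := fun k => hK.closed _ ⟨k, rfl⟩
    choose σ hσ using hex
    have hinj : Function.Injective σ := fun k l hkl => by
      apply e.injective
      apply π.injective
      rw [← hσ, ← hσ, hkl]
    have : Equiv.ofBijective σ (Finite.injective_iff_bijective.1 hinj) = ρ := by
      apply perm_eq_of_lt_iff
      intro k l
      rw [← h2, ← hσ, ← hσ, OrderEmbedding.lt_iff_lt]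
      rfl
    intro k
    rw [← this, ← hσ]
    rfl
  · rintro ⟨h1, h2⟩
    refine ⟨h1.eq_kernelSet hinv, fun k l => ?_⟩
    rw [h2, h2, OrderEmbedding.lt_iff_lt]

/-- The properties of the kernel shapes. -/
structure Shape {s : ℕ} (ρ : Equiv.Perm (Fin s)) : Prop where
  pos : 0 < s
  inv : IsInvolution ρ
  conn : Conn ρ Set.univ

theorem IsKernel.shape (hinv : IsInvolution π) (hn : 0 < n) {s : ℕ} {ρ : Equiv.Perm (Fin s)}
    {e : Fin s ↪o Fin n} (h : IsKernel ρ π e) : Shape ρ := by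
  rw [isKernel_iff hinv hn] at h
  obtain ⟨hK, he⟩ := h
  refine ⟨?_, ?_, (conn_range_iff e.strictMono he).1 hK.conn⟩
  · obtain ⟨_, ⟨k, -⟩, -⟩ := hK.bot
    exact k.pos
  · rw [isInvolution_iff]
    intro x
    apply e.injective
    rw [← he, ← he, hinv.apply_apply]

/-- Every involution has a kernel shape. -/
theorem exists_isKernel (hinv : IsInvolution π) (hn : 0 < n) :
    ∃ (s : ℕ) (ρ : Equiv.Perm (Fin s)) (e : Fin s ↪o Fin n), IsKernel ρ π e := by
  classical
  have hK := (kerSet_kernelSet hinv hn).1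
  let E : Finset (Fin n) := Finset.univ.filter (· ∈ kernelSet π)
  let e := E.orderEmbOfFin rfl
  have hr : Set.range e = kernelSet π := by
    rw [Finset.range_orderEmbOfFin]
    ext i
    simp [E]
  have hex : ∀ k, ∃ l, e l = π (e k) := fun k => by
    have : π (e k) ∈ Set.range e := by
      rw [hr]
      exact hK.closed _ (hr ▸ ⟨k, rfl⟩)
    exact this
  choose σ hσ using hex
  have hinj : Function.Injective σ := fun k l hkl => by
    apply e.injective
    apply π.injective
    rw [← hσ, ← hσ, hkl]
  refine ⟨_, Equiv.ofBijective σ (Finite.injective_iff_bijective.1 hinj), e, ?_⟩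
  rw [isKernel_iff hinv hn, hr]
  exact ⟨hK, fun k => (hσ k).symm⟩

theorem IsKernel.unique {s t : ℕ} {ρ : Equiv.Perm (Fin s)}
    {ρ' : Equiv.Perm (Fin t)} {e : Fin s ↪o Fin n} {e' : Fin t ↪o Fin n} (h : IsKernel ρ π e)
    (h' : IsKernel ρ' π e') : (⟨s, ρ⟩ : Σ s, Equiv.Perm (Fin s)) = ⟨t, ρ'⟩ := by
  have hr : Set.range e = Set.range e' := h.1.trans h'.1.symm
  have hst : s = t := by
    have h1 := Set.card_range_of_injective e.injective
    have h2 := Set.card_range_of_injective e'.injective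
    simp only [Fintype.card_fin] at h1 h2
    rw [← h1, ← h2]
    exact Fintype.card_congr (Equiv.setCongr hr)
  subst hst
  have hee : (e : Fin s → Fin n) = e' := (StrictMono.range_inj e.strictMono e'.strictMono).1 hr
  have : ρ = ρ' := perm_eq_of_lt_iff fun k l => by rw [← h.2, ← h'.2, hee]
  rw [this]

/-- The kernel embedding is unique. -/
theorem IsKernel.emb_unique {s : ℕ} {ρ : Equiv.Perm (Fin s)} {e e' : Fin s ↪o Fin n}
    (h : IsKernel ρ π e) (h' : IsKernel ρ π e') : e = e' := by
  apply DFunLike.coe_injective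
  exact (StrictMono.range_inj e.strictMono e'.strictMono).1 (h.1.trans h'.1.symm)

end Kernel

/-- The positions strictly between the `l`-th and the next position of an embedding. -/
def gap {s n : ℕ} (e : Fin s ↪o Fin n) (l : Fin s) : Set (Fin n) :=
  {x | e l < x ∧ ∀ k, l < k → x < e k}

/-! ### Gaps between kernel positions, and cells -/

section Gap

variable {s n : ℕ} {ρ : Equiv.Perm (Fin s)} {π : Equiv.Perm (Fin n)} {e : Fin s ↪o Fin n}

theorem lt_iff_of_mem_gap {l k : Fin s} {x : Fin n} (h : x ∈ gap e l) : x < e k ↔ l < k := by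
  refine ⟨fun hx => ?_, h.2 k⟩
  by_contra hk
  exact absurd (e.monotone (not_lt.1 hk)) (not_le.2 (h.1.trans hx))

theorem emb_lt_iff_of_mem_gap {l k : Fin s} {x : Fin n} (h : x ∈ gap e l) : e k < x ↔ k ≤ l := by
  refine ⟨fun hx => ?_, fun hk => (e.monotone hk).trans_lt h.1⟩
  by_contra hk
  exact absurd (h.2 k (not_le.1 hk)) (not_lt.2 hx.le)

theorem notMem_range_of_mem_gap {l : Fin s} {x : Fin n} (h : x ∈ gap e l) : x ∉ Set.range e := by
  rintro ⟨k, rfl⟩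
  by_cases hk : l < k
  · exact lt_irrefl _ (h.2 k hk)
  · exact lt_irrefl _ ((emb_lt_iff_of_mem_gap h).2 (not_lt.1 hk))

theorem gap_unique {l l' : Fin s} {x : Fin n} (h : x ∈ gap e l) (h' : x ∈ gap e l') : l = l' :=
  le_antisymm ((emb_lt_iff_of_mem_gap h').1 h.1) ((emb_lt_iff_of_mem_gap h).1 h'.1)

/-- Entries not separated by the embedded positions lie in the same gap. -/
theorem mem_gap_of_same {l : Fin s} {x y : Fin n} (h : x ∈ gap e l)
    (hxy : ∀ k, (e k < x ∧ e k < y) ∨ (x < e k ∧ y < e k)) : y ∈ gap e l := by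
  refine ⟨?_, fun k hk => ?_⟩
  · rcases hxy l with g | g
    · exact g.2
    · exact absurd g.1 (not_lt.2 h.1.le)
  · rcases hxy k with g | g
    · exact absurd g.1 (not_lt.2 (h.2 k hk).le)
    · exact g.2

theorem exists_mem_gap (hbot : ∃ k, ∀ x, e k ≤ x) {x : Fin n} (hx : x ∉ Set.range e) :
    ∃ l, x ∈ gap e l := by
  classical
  obtain ⟨k, hk⟩ := hbot
  let S : Finset (Fin s) := Finset.univ.filter (fun k => e k < x)
  have hS : S.Nonempty := ⟨k, by
    simp only [S, Finset.mem_filter, Finset.mem_univ, true_and]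
    exact lt_of_le_of_ne (hk x) (fun h => hx ⟨k, h⟩)⟩
  have hmem := S.max'_mem hS
  refine ⟨S.max' hS, by simpa [S] using hmem, fun k hk => ?_⟩
  by_contra hlt
  have : k ∈ S := by
    simp only [S, Finset.mem_filter, Finset.mem_univ, true_and]
    exact lt_of_le_of_ne (not_lt.1 hlt) (fun h => hx ⟨k, h⟩)
  exact absurd (S.le_max' k this) (not_le.2 hk)

theorem mem_cell_iff (he : ∀ k, π (e k) = e (ρ k)) {m l : Fin s} {x : Fin n} :
    x ∈ cell ρ π e m l ↔ x ∈ gap e l ∧ π x ∈ gap e m := by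
  simp [cell, gap, he]

end Gap

/-! ### Feasible cells as cuts, and kernels recognized by cells -/

section Feasible

variable {s : ℕ} {ρ : Equiv.Perm (Fin s)}

theorem Infeasible.symm {m l : Fin s} (h : Infeasible ρ m l) : Infeasible ρ l m := by
  intro n π e hinv he a ha
  rw [mem_cell_iff he] at ha
  obtain ⟨o, h1, x, y, hxy, h2, h3⟩ := h n π e hinv he (π a) (by
    rw [mem_cell_iff he, hinv.apply_apply]
    exact ⟨ha.2, ha.1⟩)
  have key : ∀ i, o.Contains i → (Occ.mk (o.is3412.mirror hinv.apply_apply)).Contains (π i) := by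
    intro i hi
    rw [Occ.contains_iff] at hi
    rw [Occ.mk_contains]
    rcases hi with rfl | rfl | rfl | rfl <;> simp
  refine ⟨Occ.mk (o.is3412.mirror hinv.apply_apply), ?_, ρ x, ρ y,
    fun h => hxy (ρ.injective h), ?_, ?_⟩
  · have := key _ h1
    rwa [hinv.apply_apply] at this
  · have := key _ h2
    rwa [he] at this
  · have := key _ h3
    rwa [he] at this

/-- A single witness suffices: whether its entry `a` forms a 3412 with three entries of the copy
depends only on the cell containing `a`. -/
theorem cutOne_of_feasible {m l : Fin s} (h : ¬ Infeasible ρ m l) :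
    CutOne ρ Set.univ l m := by
  unfold Infeasible at h
  push Not at h
  obtain ⟨n, π, e, hinv, he, a, ha, hno⟩ := h
  rw [mem_cell_iff he] at ha
  obtain ⟨g1, g2⟩ := ha
  have hno' : ∀ p q r t, Is3412 π p q r t → (a = p ∨ a = q ∨ a = r ∨ a = t) → ∀ x y, x ≠ y →
      (e x = p ∨ e x = q ∨ e x = r ∨ e x = t) → ¬ (e y = p ∨ e y = q ∨ e y = r ∨ e y = t) := by
    intro p q r t hO h1 x y hxy h2 h3
    exact hno (Occ.mk hO) ((Occ.mk_contains hO a).2 h1) x y hxy ((Occ.mk_contains hO _).2 h2)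
      ((Occ.mk_contains hO _).2 h3)
  have p1 := fun k => @lt_iff_of_mem_gap _ _ e l k a g1
  have p2 := fun k => @emb_lt_iff_of_mem_gap _ _ e l k a g1
  have p3 := fun k => @lt_iff_of_mem_gap _ _ e m k _ g2
  have p4 := fun k => @emb_lt_iff_of_mem_gap _ _ e m k _ g2
  constructor
  · intro x _ y _ z _ h1 h2 h3 h4 h5 h6
    refine hno' a (e x) (e y) (e z) ?_ (by simp) x y h2.ne (by simp) (by simp)
    simp only [Is3412, he, e.lt_iff_lt, p1, p3, p4]
    exact ⟨h1, h2, h3, h5, h6, h4⟩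
  · intro w _ y _ z _ h1 h2 h3 h4 h5 h6
    refine hno' (e w) a (e y) (e z) ?_ (by simp) y z h3.ne (by simp) (by simp)
    simp only [Is3412, he, e.lt_iff_lt, p1, p2, p4]
    exact ⟨h1, h2, h3, h4, h5, h6⟩
  · intro w _ x _ z _ h1 h2 h3 h4 h5 h6
    refine hno' (e w) (e x) a (e z) ?_ (by simp) w x h1.ne (by simp) (by simp)
    simp only [Is3412, he, e.lt_iff_lt, p1, p2, p3]
    exact ⟨h1, h2, h3, h4, h5, h6⟩
  · intro w _ x _ y _ h1 h2 h3 h4 h5 h6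
    refine hno' (e w) (e x) (e y) a ?_ (by simp) w x h1.ne (by simp) (by simp)
    simp only [Is3412, he, e.lt_iff_lt, p2, p3, p4]
    exact ⟨h1, h2, h3, h4, h5, h6⟩

theorem cut_of_feasible {m l : Fin s} (h : ¬ Infeasible ρ m l) (hlm : l ≤ m) :
    Cut ρ Set.univ l m := by
  have up := cutOne_of_feasible h
  have down := cutOne_of_feasible (fun h' : Infeasible ρ l m => h h'.symm)
  unfold Infeasible at h
  push Not at h
  obtain ⟨n, π, e, hinv, he, a, ha, hno⟩ := h
  rw [mem_cell_iff he] at ha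
  obtain ⟨g1, g2⟩ := ha
  refine ⟨hlm, up, down, ?_, ?_⟩
  · intro x _ h1 h2 h3
    have hO : Is3412 π (e x) a (π (e x)) (π a) := is3412_of_cross hinv.apply_apply
      ((emb_lt_iff_of_mem_gap g1).2 h1) (by rw [he]; exact (lt_iff_of_mem_gap g1).2 h2)
      (by rw [he]; exact (emb_lt_iff_of_mem_gap g2).2 h3)
    exact hno (Occ.mk hO) ((Occ.mk_contains hO a).2 (by simp)) x (ρ x) (h1.trans_lt h2).ne
      ((Occ.mk_contains hO _).2 (by simp)) ((Occ.mk_contains hO _).2 (by simp [he]))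
  · intro x _ h1 h2 h3
    have hO : Is3412 π a (e x) (π a) (π (e x)) := is3412_of_cross hinv.apply_apply
      ((lt_iff_of_mem_gap g1).2 h1) ((emb_lt_iff_of_mem_gap g2).2 h2)
      (by rw [he]; exact (lt_iff_of_mem_gap g2).2 h3)
    exact hno (Occ.mk hO) ((Occ.mk_contains hO a).2 (by simp)) x (ρ x) (h2.trans_lt h3).ne
      ((Occ.mk_contains hO _).2 (by simp)) ((Occ.mk_contains hO _).2 (by simp [he]))

/-- If `l₁ < l₂`, the core entry `l₂` itself would separate the two left ends; `m₂` plays the same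
part for the right ends. -/
theorem Shape.cut_eq (hρ : Shape ρ) {l₁ m₁ l₂ m₂ : Fin s} (h₁ : Cut ρ Set.univ l₁ m₁)
    (h₂ : Cut ρ Set.univ l₂ m₂) (hl : l₁ ≤ l₂) (hlm : l₂ ≤ m₁) (hm : m₁ ≤ m₂) :
    l₁ = l₂ ∧ m₁ = m₂ := by
  have hbot : (⟨0, hρ.pos⟩ : Fin s) ≤ l₁ := by rw [Fin.le_def]; exact Nat.zero_le _
  have hE : ∀ x ∈ (Set.univ : Set (Fin s)), ρ x ∈ (Set.univ : Set (Fin s)) := fun _ _ => trivial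
  constructor
  · refine le_antisymm hl (not_lt.1 fun hlt => ?_)
    exact Cut.no_sep_left hρ.inv.apply_apply hE hρ.conn (Set.mem_univ _) h₁ h₂ hbot hlm hm
      (Set.mem_univ l₂) hlt le_rfl
  · refine le_antisymm hm (not_lt.1 fun hlt => ?_)
    exact Cut.no_sep_right hρ.inv.apply_apply hE hρ.conn (Set.mem_univ _) h₁ h₂ hbot hl hlm
      (Set.mem_univ m₂) hlt le_rfl

/-- Distinct feasible cells lie in distinct columns. -/
theorem Shape.feasible_unique (hρ : Shape ρ) {i j j' : Fin s} (h : ¬ Infeasible ρ j i)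
    (h' : ¬ Infeasible ρ j' i) : j = j' := by
  wlog hjj : j ≤ j' generalizing j j'
  · exact (this h' h (not_le.1 hjj).le).symm
  have hs : ¬ Infeasible ρ i j := fun g => h g.symm
  have hs' : ¬ Infeasible ρ i j' := fun g => h' g.symm
  -- Cells are read as arcs, after transposition if below the diagonal. The two arcs share their
  -- left end, meet at `i`, or share their right end.
  rcases le_total i j with g | g
  · exact (hρ.cut_eq (cut_of_feasible h g) (cut_of_feasible h' (g.trans hjj)) le_rfl g hjj).2
  · rcases le_total i j' with g' | g'
    · have := hρ.cut_eq (cut_of_feasible hs g) (cut_of_feasible h' g') g le_rfl g'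
      exact this.1.trans this.2
    · exact (hρ.cut_eq (cut_of_feasible hs g) (cut_of_feasible hs' g') hjj g' le_rfl).1

/-- The cells off the diagonal decrease. -/
theorem Shape.alwaysDecreasing_of_ne {m l : Fin s} (hml : m ≠ l) :
    AlwaysDecreasing ρ m l := by
  intro n π e hinv hK p hp q hq hpq
  have hn : 0 < n := p.pos
  rw [isKernel_iff hinv hn] at hK
  obtain ⟨hK, he⟩ := hK
  rw [mem_cell_iff he] at hp hq
  by_contra hlt
  have hlt : π p < π q := lt_of_le_of_ne (not_lt.1 hlt) (fun h => hpq.ne (π.injective h))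
  obtain ⟨o, ho, hbot⟩ := hK.bot
  have key : ∀ p ∉ Set.range e, ∀ q ∉ Set.range e, p < q → q < π p → π p < π q → ∀ z ∈ Set.range e,
      ¬ (p < z ∧ z < π q) := fun p hp q hq h1 h2 h3 z hz =>
    (hK.tame hinv.apply_apply).no_core_of_cross hinv.apply_apply hK.closed hK.conn ho hbot
      hp hq h1 h2 h3 hz
  -- An increasing pair gives crossing arcs outside the core, whose span contains a core entry: `e
  -- l` if `m < l`, and `e m` otherwise.
  rcases lt_or_gt_of_ne hml with g | g
  · have h1 : π q < e l := hq.2.2 l g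
    refine key (π p) (notMem_range_of_mem_gap hp.2) (π q) (notMem_range_of_mem_gap hq.2) hlt ?_ ?_
      (e l) ⟨l, rfl⟩ ?_
    · rw [hinv.apply_apply]; exact h1.trans hp.1.1
    · rwa [hinv.apply_apply, hinv.apply_apply]
    · rw [hinv.apply_apply]; exact ⟨hlt.trans h1, hq.1.1⟩
  · have h1 : q < e m := hq.1.2 m g
    exact key p (notMem_range_of_mem_gap hp.1) q (notMem_range_of_mem_gap hq.1) hpq
      (h1.trans hp.2.1) hlt (e m) ⟨m, rfl⟩ ⟨hpq.trans h1, hq.2.1⟩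

/-- An increase in the cell would form a 3412 with the core entries `x`, `y` and so belong to the
kernel. -/
theorem alwaysDecreasing_of_pair {m l x y : Fin s} (hxy : x < y) (hyl : y ≤ l)
    (hρ : ρ x < ρ y) (hm : m < ρ x) : AlwaysDecreasing ρ m l := by
  intro n π e hinv hK p hp q hq hpq
  have hn : 0 < n := p.pos
  rw [isKernel_iff hinv hn] at hK
  obtain ⟨hK, he⟩ := hK
  rw [mem_cell_iff he] at hp hq
  by_contra hlt
  have hlt : π p < π q := lt_of_le_of_ne (not_lt.1 hlt) (fun h => hpq.ne (π.injective h))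
  have := hK.sat (e x) (e y) p q ⟨e.strictMono hxy, (emb_lt_iff_of_mem_gap hp.1).2 hyl, hpq, hlt,
    by rw [he]; exact hq.2.2 _ hm, by rw [he, he]; exact e.strictMono hρ⟩ (Or.inl ⟨x, rfl⟩)
  exact notMem_range_of_mem_gap hp.1 this.2.2.1

/-- The positions of a kernel, characterized by the cells of the remaining entries. -/
structure Fits {n : ℕ} (ρ : Equiv.Perm (Fin s)) (π : Equiv.Perm (Fin n)) (e : Fin s ↪o Fin n) :
    Prop where
  map : ∀ k, π (e k) = e (ρ k)
  bot : ∃ k, ∀ x, e k ≤ x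
  feas : ∀ l, ∀ x ∈ gap e l, ∃ m, ¬ Infeasible ρ m l ∧ π x ∈ gap e m
  dec : ∀ m l, AlwaysDecreasing ρ m l → StrictAntiOn π (cell ρ π e m l)

variable {n : ℕ} {π : Equiv.Perm (Fin n)} {e : Fin s ↪o Fin n}

theorem IsKernel.fits (hinv : IsInvolution π) (hn : 0 < n) (h : IsKernel ρ π e) :
    Fits ρ π e := by
  have hK := h
  rw [isKernel_iff hinv hn] at hK
  obtain ⟨hK, he⟩ := hK
  have hbot : ∃ k, ∀ x, e k ≤ x := by
    obtain ⟨_, ⟨k, rfl⟩, hk⟩ := hK.bot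
    exact ⟨k, hk⟩
  refine ⟨he, hbot, ?_, fun m l hd => hd n π e hinv h⟩
  intro l x hx
  have hx' : π x ∉ Set.range e :=
    not_mem_map hinv.apply_apply hK.closed (notMem_range_of_mem_gap hx)
  obtain ⟨m, hm⟩ := exists_mem_gap hbot hx'
  refine ⟨m, fun hinf => ?_, hm⟩
  obtain ⟨o, h1, y, z, -, h2, -⟩ := hinf n π e hinv he x ((mem_cell_iff he).2 ⟨hx, hm⟩)
  rw [Occ.contains_iff] at h1 h2
  have := hK.sat _ _ _ _ o.is3412 (by
    rcases h2 with h2 | h2 | h2 | h2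
    · exact Or.inl ⟨y, h2⟩
    · exact Or.inr (Or.inl ⟨y, h2⟩)
    · exact Or.inr (Or.inr (Or.inl ⟨y, h2⟩))
    · exact Or.inr (Or.inr (Or.inr ⟨y, h2⟩)))
  apply notMem_range_of_mem_gap hx
  rcases h1 with h1 | h1 | h1 | h1 <;> rw [h1]
  exacts [this.1, this.2.1, this.2.2.1, this.2.2.2]

/-- Feasibility excludes the three-entry patterns and the crossings with core arcs. For `two`,
unseparated entries share a cell, and the increasing core pair above it forces that cell to
decrease. -/
theorem Fits.tame (hinv : IsInvolution π) (h : Fits ρ π e) :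
    Tame π (Set.range e) := by
  have he := h.map
  have hcell : ∀ p ∉ Set.range e, ∃ l m, ¬ Infeasible ρ m l ∧ p ∈ gap e l ∧ π p ∈ gap e m := by
    intro p hp
    obtain ⟨l, hl⟩ := exists_mem_gap h.bot hp
    obtain ⟨m, hm, hm'⟩ := h.feas l p hl
    exact ⟨l, m, hm, hl, hm'⟩
  constructor
  · rintro a _ _ _ ⟨h1, h2, h3, h4, h5, h6⟩ ⟨x, rfl⟩ ⟨y, rfl⟩ ⟨z, rfl⟩
    by_contra hp
    obtain ⟨l, m, hf, g1, g2⟩ := hcell a hp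
    simp only [he, e.lt_iff_lt, lt_iff_of_mem_gap g1, lt_iff_of_mem_gap g2,
      emb_lt_iff_of_mem_gap g2] at h1 h2 h3 h4 h5 h6
    exact (cutOne_of_feasible hf).fst x trivial y trivial z trivial h1 h2 h3 h6 h4 h5
  · rintro _ a _ _ ⟨h1, h2, h3, h4, h5, h6⟩ ⟨x, rfl⟩ ⟨y, rfl⟩ ⟨z, rfl⟩
    by_contra hp
    obtain ⟨l, m, hf, g1, g2⟩ := hcell a hp
    simp only [he, e.lt_iff_lt, lt_iff_of_mem_gap g1, emb_lt_iff_of_mem_gap g1,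
      emb_lt_iff_of_mem_gap g2] at h1 h2 h3 h4 h5 h6
    exact (cutOne_of_feasible hf).snd x trivial y trivial z trivial h1 h2 h3 h4 h5 h6
  · rintro _ ⟨x, rfl⟩ p hp h1 h2 h3
    obtain ⟨l, m, hf, g1, g2⟩ := hcell p hp
    simp only [he, lt_iff_of_mem_gap g1, emb_lt_iff_of_mem_gap g1, emb_lt_iff_of_mem_gap g2]
      at h1 h2 h3
    exact (cut_of_feasible hf (h2.le.trans h3)).cross_left x trivial h1 h2 h3
  · rintro _ ⟨x, rfl⟩ p hp h1 h2 h3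
    obtain ⟨l, m, hf, g1, g2⟩ := hcell p hp
    simp only [he, lt_iff_of_mem_gap g1, emb_lt_iff_of_mem_gap g2, lt_iff_of_mem_gap g2]
      at h1 h2 h3
    exact (cut_of_feasible hf (h1.le.trans h2)).cross_right x trivial h1 h2 h3
  · rintro _ _ c d ⟨h1, h2, h3, h4, h5, h6⟩ ⟨x, rfl⟩ ⟨y, rfl⟩ hc hd
    by_contra hno
    push Not at hno
    obtain ⟨l, m, hf, g1, g2⟩ := hcell c hc
    have hcl : ∀ x ∈ Set.range e, π x ∈ Set.range e := by
      rintro _ ⟨k, rfl⟩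
      exact ⟨ρ k, (he k).symm⟩
    have hc' := not_mem_map hinv.apply_apply hcl hc
    have hd' := not_mem_map hinv.apply_apply hcl hd
    have sep : ∀ u v : Fin n, u ∉ Set.range e → v ∉ Set.range e → u < v →
        (∀ k, ¬ (u < e k ∧ e k < v)) → ∀ k, (e k < u ∧ e k < v) ∨ (u < e k ∧ v < e k) := by
      intro u v hu hv huv hno k
      rcases lt_trichotomy (e k) u with g | g | g
      · exact Or.inl ⟨g, g.trans huv⟩
      · exact absurd ⟨k, g⟩ hu
      · rcases lt_trichotomy (e k) v with g' | g' | g'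
        · exact absurd ⟨g, g'⟩ (hno k)
        · exact absurd ⟨k, g'⟩ hv
        · exact Or.inr ⟨g, g'⟩
    have g3 : d ∈ gap e l := mem_gap_of_same g1 (sep c d hc hd h3 fun k hk =>
      absurd hk.2 (not_lt.2 ((hno (e k) ⟨k, rfl⟩).1 hk.1)))
    have g4 : π d ∈ gap e m := mem_gap_of_same g2 (sep _ _ hc' hd' h4 fun k hk =>
      absurd hk.2 (not_lt.2 ((hno (e k) ⟨k, rfl⟩).2 hk.1)))
    rw [e.lt_iff_lt] at h1
    rw [emb_lt_iff_of_mem_gap g1] at h2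
    rw [he, lt_iff_of_mem_gap g4] at h5
    rw [he, he, e.lt_iff_lt] at h6
    have := h.dec m l (alwaysDecreasing_of_pair h1 h2 h6 h5) ((mem_cell_iff he).2 ⟨g1, g2⟩)
      ((mem_cell_iff he).2 ⟨g3, g4⟩) h3
    exact absurd h4 (not_lt.2 this.le)

/-- The converse of `IsKernel.fits`. Conditions on single cells already characterize the kernel,
which is why the cells can be filled independently. -/
theorem Fits.isKernel (hρ : Shape ρ) (hinv : IsInvolution π) (h : Fits ρ π e) :
    IsKernel ρ π e := by
  obtain ⟨k, hk⟩ := h.bot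
  rw [isKernel_iff hinv (e k).pos]
  refine ⟨(h.tame hinv).sat hinv.apply_apply ?_
    ((conn_range_iff e.strictMono h.map).2 hρ.conn) ⟨k, rfl⟩ hk, h.map⟩
  rintro _ ⟨k, rfl⟩
  exact ⟨ρ k, (h.map k).symm⟩

/-- The occurrences of `3412` outside the kernel lie in single diagonal cells. -/
theorem IsKernel.numOcc_eq (hinv : IsInvolution π) (hn : 0 < n) (h : IsKernel ρ π e) :
    numOcc π = numOcc ρ + ∑ l, (occIn π (gap e l)).ncard ∧
      ∀ l, ∀ a b c d, Is3412 π a b c d → a ∈ gap e l → b ∈ gap e l → c ∈ gap e l → d ∈ gap e l →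
        π c ∈ gap e l := by
  have hK := h
  rw [isKernel_iff hinv hn] at hK
  obtain ⟨hK, he⟩ := hK
  have hbot : ∃ k, ∀ x, e k ≤ x := by
    obtain ⟨_, ⟨k, rfl⟩, hk⟩ := hK.bot
    exact ⟨k, hk⟩
  obtain ⟨o, ho, hbot'⟩ := hK.bot
  have hloc : ∀ a b c d, Is3412 π a b c d → a ∉ Set.range e → ∀ l, a ∈ gap e l →
      b ∈ gap e l ∧ c ∈ gap e l ∧ d ∈ gap e l ∧ π c ∈ gap e l := by
    intro a b c d hO ha l hal
    rcases (hK.tame hinv.apply_apply).occ_core_or_gap hinv.apply_apply hK.closed hK.conn ho hbot'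
      hO with g | g
    · exact absurd g.1 ha
    · obtain ⟨o1, o2, o3, o4, o5, o6⟩ := hO
      refine ⟨?_, ?_, ?_, ?_⟩ <;> refine mem_gap_of_same hal fun k => ?_ <;>
        rcases g (e k) ⟨k, rfl⟩ with g | g
      · exact Or.inl ⟨g.1, g.1.trans o1⟩
      · exact Or.inr ⟨(o1.trans (o2.trans o3)).trans g.1, (o2.trans o3).trans g.1⟩
      · exact Or.inl ⟨g.1, g.1.trans (o1.trans o2)⟩
      · exact Or.inr ⟨(o1.trans (o2.trans o3)).trans g.1, o3.trans g.1⟩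
      · exact Or.inl ⟨g.1, g.1.trans (o1.trans (o2.trans o3))⟩
      · exact Or.inr ⟨(o1.trans (o2.trans o3)).trans g.1, g.1⟩
      · exact Or.inl g
      · exact Or.inr ⟨(o1.trans (o2.trans o3)).trans g.1, (o4.trans (o5.trans o6)).trans g.2⟩
  refine ⟨?_, fun l a b c d hO ha _ _ _ => (hloc a b c d hO (notMem_range_of_mem_gap ha) l ha).2.2.2⟩
  have hsplit : occIn π Set.univ = occIn π (Set.range e) ∪ ⋃ l, occIn π (gap e l) := by
    ext ⟨a, b, c, d⟩
    constructor
    · rintro ⟨hO, -⟩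
      by_cases ha : a ∈ Set.range e
      · exact Or.inl ⟨hO, hK.sat a b c d hO (Or.inl ha)⟩
      · obtain ⟨l, hl⟩ := exists_mem_gap hbot ha
        have := hloc a b c d hO ha l hl
        exact Or.inr (Set.mem_iUnion.2 ⟨l, hO, hl, this.1, this.2.1, this.2.2.1⟩)
    · rintro (h | h)
      · exact ⟨h.1, trivial, trivial, trivial, trivial⟩
      · obtain ⟨l, h⟩ := Set.mem_iUnion.1 h
        exact ⟨h.1, trivial, trivial, trivial, trivial⟩
  rw [numOcc_eq_ncard, numOcc_eq_ncard, hsplit, Set.ncard_union_eq ?_ (Set.toFinite _)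
    (Set.toFinite _), ncard_occIn_range e.strictMono he]
  · congr 1
    rw [Set.ncard_iUnion_of_finite, finsum_eq_sum_of_fintype]
    · exact fun l => Set.toFinite _
    · intro i j hij
      rw [Function.onFun, Set.disjoint_left]
      exact fun q hq hq' => hij (gap_unique hq.2.1 hq'.2.1)
  · rw [Set.disjoint_left]
    intro q hq hq'
    obtain ⟨l, hl⟩ := Set.mem_iUnion.1 hq'
    exact notMem_range_of_mem_gap hl.2.1 hq.2.1

end Feasible

/-! ### Pairing of columns by their feasible cells -/

section Mate

variable {s : ℕ} {ρ : Equiv.Perm (Fin s)}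

/-- The column `i` contains a feasible cell. -/
def Live (ρ : Equiv.Perm (Fin s)) (i : Fin s) : Prop := ∃ j, ¬ Infeasible ρ j i

open Classical in
/-- The row of the feasible cell in the column `i`. -/
noncomputable def mate (ρ : Equiv.Perm (Fin s)) (i : Fin s) : Fin s :=
  if h : Live ρ i then h.choose else i

theorem feasible_mate {i : Fin s} (h : Live ρ i) : ¬ Infeasible ρ (mate ρ i) i := by
  unfold mate
  rw [dif_pos h]
  exact h.choose_spec

theorem mate_of_not_live {i : Fin s} (h : ¬ Live ρ i) : mate ρ i = i := by
  unfold mate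
  rw [dif_neg h]

theorem Shape.mate_eq (hρ : Shape ρ) {i j : Fin s} (h : ¬ Infeasible ρ j i) : mate ρ i = j :=
  hρ.feasible_unique (feasible_mate ⟨j, h⟩) h

theorem live_mate {i : Fin s} (h : Live ρ i) : Live ρ (mate ρ i) :=
  ⟨i, fun g => feasible_mate h g.symm⟩

theorem Shape.mate_mate (hρ : Shape ρ) (i : Fin s) : mate ρ (mate ρ i) = i := by
  by_cases h : Live ρ i
  · exact hρ.mate_eq fun g => feasible_mate h g.symm
  · rw [mate_of_not_live h, mate_of_not_live h]

end Mate

/-- Involutions of all lengths. -/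
abbrev Inv : Type := Σ n : ℕ, {σ : Equiv.Perm (Fin n) // IsInvolution σ}

/-- An involution as a function on the natural numbers. -/
def Inv.app (x : Inv) (j : ℕ) : ℕ := if h : j < x.1 then x.2.1 ⟨j, h⟩ else j

theorem Inv.app_lt (x : Inv) {j : ℕ} (h : j < x.1) : x.app j < x.1 := by
  rw [Inv.app, dif_pos h]
  exact Fin.is_lt _

theorem Inv.app_app (x : Inv) (j : ℕ) : x.app (x.app j) = j := by
  by_cases h : j < x.1
  · have : x.app j = x.2.1 ⟨j, h⟩ := by rw [Inv.app, dif_pos h]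
    rw [this, Inv.app, dif_pos (Fin.is_lt _)]
    simp [x.2.2.apply_apply]
  · have : x.app j = j := by rw [Inv.app, dif_neg h]
    rw [this, this]

theorem Inv.app_fin (x : Inv) (j : Fin x.1) : x.app j = x.2.1 j := by
  rw [Inv.app, dif_pos j.2]

theorem isInvolution_revPerm (n : ℕ) : IsInvolution (Fin.revPerm : Equiv.Perm (Fin n)) :=
  isInvolution_iff.2 fun x => by simp

/-- The decreasing involution. -/
def Inv.rev (n : ℕ) : Inv := ⟨n, Fin.revPerm, isInvolution_revPerm n⟩

/-! ### Contents of the gaps determine the involution -/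

section Fill

variable {s : ℕ} {ρ : Equiv.Perm (Fin s)}

/-- Admissible contents of the gaps of a kernel shape. -/
structure Fill (ρ : Equiv.Perm (Fin s)) (S : Fin s → Inv) : Prop where
  mate : ∀ i, S (mate ρ i) = S i
  live : ∀ i, (S i).1 ≠ 0 → Live ρ i
  dec : ∀ i, AlwaysDecreasing ρ (InvKernel.mate ρ i) i → S i = Inv.rev (S i).1

/-- The gaps of `e` in `π` have the contents `S`. -/
def Realizes (ρ : Equiv.Perm (Fin s)) {n : ℕ} (π : Equiv.Perm (Fin n)) (e : Fin s ↪o Fin n)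
    (S : Fin s → Inv) : Prop :=
  ∀ i, ∃ g h : Fin (S i).1 ↪o Fin n, Set.range g = gap e i ∧ Set.range h = gap e (mate ρ i) ∧
    ∀ j, π (g j) = h ((S i).2.1 j)

theorem emb_eq_of_range {m n : ℕ} {g g' : Fin m ↪o Fin n} (h : Set.range g = Set.range g') :
    g = g' :=
  DFunLike.coe_injective ((StrictMono.range_inj g.strictMono g'.strictMono).1 h)

theorem ncard_range_emb {m n : ℕ} (g : Fin m ↪o Fin n) : (Set.range g).ncard = m := by
  rw [← Set.image_univ, Set.ncard_image_of_injective _ g.injective, Set.ncard_univ]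
  simp

theorem eq_revPerm_of_strictAnti {n : ℕ} {σ : Equiv.Perm (Fin n)} (h : StrictAnti σ) :
    σ = Fin.revPerm := by
  apply perm_eq_of_lt_iff
  intro k l
  rw [h.lt_iff_gt]
  simp

theorem Realizes.unique {n : ℕ} {π : Equiv.Perm (Fin n)} {e : Fin s ↪o Fin n} {S S' : Fin s → Inv}
    (h : Realizes ρ π e S) (h' : Realizes ρ π e S') : S = S' := by
  have aux : ∀ (i : Fin s) (x x' : Inv), (∃ g h : Fin x.1 ↪o Fin n, Set.range g = gap e i ∧
      Set.range h = gap e (mate ρ i) ∧ ∀ j, π (g j) = h (x.2.1 j)) →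
      (∃ g h : Fin x'.1 ↪o Fin n, Set.range g = gap e i ∧
      Set.range h = gap e (mate ρ i) ∧ ∀ j, π (g j) = h (x'.2.1 j)) → x = x' := by
    rintro i ⟨m, σ, hσ⟩ ⟨m', σ', hσ'⟩ ⟨g, k, h1, h2, h3⟩ ⟨g', k', h1', h2', h3'⟩
    have hn : m = m' := by
      have e1 := ncard_range_emb g
      have e2 := ncard_range_emb g'
      rw [h1] at e1
      rw [h1', e1] at e2
      exact e2
    subst hn
    obtain rfl := emb_eq_of_range (h1.trans h1'.symm)
    obtain rfl := emb_eq_of_range (h2.trans h2'.symm)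
    congr 2
    ext j
    have := (h3 j).symm.trans (h3' j)
    rw [k.injective this]
  funext i
  exact aux i _ _ (h i) (h' i)

/-- Both copies contain the least position, so the gap sizes fix all later positions one after
another. -/
theorem emb_eq_of_ncard_gap {n : ℕ} {e e' : Fin s ↪o Fin n} (hbot : ∃ k, ∀ x, e k ≤ x)
    (hbot' : ∃ k, ∀ x, e' k ≤ x) (h : ∀ i, (gap e i).ncard = (gap e' i).ncard) : e = e' := by
  have card : ∀ (e : Fin s ↪o Fin n) (i : ℕ) (hi : i + 1 < s),
      (gap e ⟨i, by omega⟩).ncard = (e ⟨i + 1, hi⟩ : ℕ) - e ⟨i, by omega⟩ - 1 := by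
    intro e i hi
    have : gap e ⟨i, by omega⟩ = ((Finset.Ioo (e ⟨i, by omega⟩) (e ⟨i + 1, hi⟩) :
        Finset (Fin n)) : Set (Fin n)) := by
      ext x
      simp only [gap, Set.mem_ofPred_eq, Finset.coe_Ioo, Set.mem_Ioo]
      refine and_congr_right fun _ => ⟨fun h => h _ (by simp [Fin.lt_def]), fun h k hk => ?_⟩
      refine h.trans_le (e.monotone ?_)
      rw [Fin.lt_def] at hk
      rw [Fin.le_def]
      exact hk
    rw [this, Set.ncard_coe_finset, Fin.card_Ioo]
  have zero : ∀ (e : Fin s ↪o Fin n), (∃ k, ∀ x, e k ≤ x) → ∀ h0 : 0 < s,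
      (e ⟨0, h0⟩ : ℕ) = 0 := by
    rintro e ⟨k, hk⟩ h0
    have hk0 : k = ⟨0, h0⟩ := le_antisymm (e.le_iff_le.1 (hk _)) (by simp [Fin.le_def])
    have := hk ⟨0, (e k).pos⟩
    rw [hk0, Fin.le_def] at this
    simpa using this
  have main : ∀ (i : ℕ) (hi : i < s), (e ⟨i, hi⟩ : ℕ) = e' ⟨i, hi⟩ := by
    intro i
    induction i with
    | zero => intro hi; rw [zero e hbot, zero e' hbot']
    | succ i ih =>
      intro hi
      have h1 := card e i hi
      have h2 := card e' i hi
      have h3 := h ⟨i, by omega⟩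
      have h4 := ih (by omega)
      have h5 : (e ⟨i, by omega⟩ : ℕ) < e ⟨i + 1, hi⟩ := e.strictMono (by simp [Fin.lt_def])
      have h6 : (e' ⟨i, by omega⟩ : ℕ) < e' ⟨i + 1, hi⟩ := e'.strictMono (by simp [Fin.lt_def])
      omega
  ext ⟨i, hi⟩
  exact main i hi

theorem Realizes.perm_unique {n : ℕ} {π π' : Equiv.Perm (Fin n)} {e e' : Fin s ↪o Fin n}
    {S : Fin s → Inv} (h : Realizes ρ π e S) (h' : Realizes ρ π' e' S) (hF : Fits ρ π e)
    (hF' : Fits ρ π' e') : π = π' := by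
  have hee : e = e' := emb_eq_of_ncard_gap hF.bot hF'.bot fun i => by
    obtain ⟨g, -, h1, -⟩ := h i
    obtain ⟨g', -, h1', -⟩ := h' i
    rw [← h1, ← h1', ncard_range_emb, ncard_range_emb]
  subst hee
  ext x
  congr 1
  by_cases hx : x ∈ Set.range e
  · obtain ⟨k, rfl⟩ := hx
    rw [hF.map, hF'.map]
  · obtain ⟨i, hi⟩ := exists_mem_gap hF.bot hx
    obtain ⟨g, k, h1, h2, h3⟩ := h i
    obtain ⟨g', k', h1', h2', h3'⟩ := h' i
    obtain rfl := emb_eq_of_range (h1.trans h1'.symm)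
    obtain rfl := emb_eq_of_range (h2.trans h2'.symm)
    rw [← h1] at hi
    obtain ⟨j, rfl⟩ := hi
    rw [h3, h3']

theorem Fits.map_gap (hρ : Shape ρ) {n : ℕ} {π : Equiv.Perm (Fin n)} {e : Fin s ↪o Fin n}
    (hF : Fits ρ π e) {i : Fin s} {x : Fin n} (hx : x ∈ gap e i) :
    π x ∈ gap e (mate ρ i) := by
  obtain ⟨m, hm, hx'⟩ := hF.feas i x hx
  rwa [hρ.mate_eq hm]

theorem Fits.exists_realizes (hρ : Shape ρ) {n : ℕ} {π : Equiv.Perm (Fin n)}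
    (hinv : IsInvolution π) {e : Fin s ↪o Fin n} (hF : Fits ρ π e) :
    ∃ S, Fill ρ S ∧ Realizes ρ π e S := by
  classical
  have hcard : ∀ i, (gap e (mate ρ i)).ncard = (gap e i).ncard := by
    have hle : ∀ i, (gap e i).ncard ≤ (gap e (mate ρ i)).ncard := fun i =>
      Set.ncard_le_ncard_of_injOn π (fun x hx => hF.map_gap hρ hx) (π.injective.injOn)
        (Set.toFinite _)
    intro i
    refine le_antisymm ?_ (hle i)
    have := hle (mate ρ i)
    rwa [hρ.mate_mate] at this
  have henum : ∀ i w, (gap e i).ncard = w → ∃ g : Fin w ↪o Fin n, Set.range g = gap e i := by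
    rintro i _ rfl
    have h1 : (gap e i).toFinset.card = (gap e i).ncard := by
      rw [Set.ncard_eq_toFinset_card']
    refine ⟨(gap e i).toFinset.orderEmbOfFin h1, ?_⟩
    rw [Finset.range_orderEmbOfFin, Set.coe_toFinset]
  have hex : ∀ i, ∃ x : Inv, x.1 = (gap e i).ncard ∧
      (∃ g h : Fin x.1 ↪o Fin n, Set.range g = gap e i ∧ Set.range h = gap e (mate ρ i) ∧
        ∀ j, π (g j) = h (x.2.1 j)) ∧
      (AlwaysDecreasing ρ (mate ρ i) i → x = Inv.rev x.1) := by
    intro i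
    obtain ⟨g, hg⟩ := henum i _ rfl
    obtain ⟨h, hh⟩ := henum (mate ρ i) _ (hcard i)
    have hgm : ∀ j, g j ∈ gap e i := fun j => hg.subset ⟨j, rfl⟩
    have hσ : ∀ j, ∃ k, h k = π (g j) := fun j => by
      have : π (g j) ∈ Set.range h := hh.symm.subset (hF.map_gap hρ (hgm j))
      exact this
    choose σ hσ using hσ
    have hinj : Function.Injective σ := fun j k hjk => by
      apply g.injective
      apply π.injective
      rw [← hσ, ← hσ, hjk]
    let τ := Equiv.ofBijective σ (Finite.injective_iff_bijective.1 hinj)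
    have hrev : AlwaysDecreasing ρ (mate ρ i) i → τ = Fin.revPerm := by
      intro hd
      apply eq_revPerm_of_strictAnti
      intro j k hjk
      have hmem : ∀ j, g j ∈ cell ρ π e (mate ρ i) i := fun j =>
        (mem_cell_iff hF.map).2 ⟨hgm j, hF.map_gap hρ (hgm j)⟩
      have := hF.dec _ _ hd (hmem j) (hmem k) (g.strictMono hjk)
      rw [← hσ, ← hσ, h.lt_iff_lt] at this
      exact this
    have hτ : IsInvolution τ := by
      -- On the diagonal `τ` inherits involutivity from `π`. Off the diagonal it compares two
      -- different gaps, and is an involution only because it is the reversal.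
      by_cases hi : mate ρ i = i
      · rw [isInvolution_iff]
        have hgh : g = h := emb_eq_of_range (by rw [hg, hh, hi])
        intro j
        apply h.injective
        change h (σ (σ j)) = h j
        rw [hσ, hgh, hσ, hinv.apply_apply, hgh]
      · rw [hrev (Shape.alwaysDecreasing_of_ne hi)]
        exact isInvolution_revPerm _
    refine ⟨⟨_, τ, hτ⟩, rfl, ⟨g, h, hg, hh, fun j => (hσ j).symm⟩, fun hd => ?_⟩
    simp only [Inv.rev, hrev hd]
  choose S hS1 hS2 hS3 using hex
  refine ⟨S, ⟨?_, ?_, hS3⟩, hS2⟩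
  · intro i
    by_cases hi : mate ρ i = i
    · rw [hi]
    · have h1 := hS3 i (Shape.alwaysDecreasing_of_ne hi)
      have h2 := hS3 (mate ρ i) (Shape.alwaysDecreasing_of_ne
        (by rw [hρ.mate_mate]; exact fun h => hi h.symm))
      rw [h1, h2, hS1, hS1, hcard]
  · intro i hi
    rw [hS1] at hi
    obtain ⟨x, hx⟩ := Set.nonempty_of_ncard_ne_zero hi
    obtain ⟨m, hm, -⟩ := hF.feas i x hx
    exact ⟨m, hm⟩

end Fill

/-! ### Building an involution from gap contents -/

section Slots

variable {s : ℕ}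

/-- The positions of a permutation whose `i`-th gap has the size `w i`, ordered lexicographically:
`(i, 0)` stands for the `i`-th kernel position, and `(i, j + 1)` for the entries of the gap. -/
abbrev Slots (w : Fin s → ℕ) : Type := {x : Fin s ×ₗ ℕ // (ofLex x).2 ≤ w (ofLex x).1}

variable {w : Fin s → ℕ}

def Slots.mk (i : Fin s) (j : ℕ) (h : j ≤ w i) : Slots w := ⟨toLex (i, j), h⟩

theorem Slots.exists_eq (x : Slots w) : (∃ i, x = Slots.mk i 0 (Nat.zero_le _)) ∨
    ∃ i j, ∃ h : j + 1 ≤ w i, x = Slots.mk i (j + 1) h := by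
  obtain ⟨x, h⟩ := x
  obtain ⟨i, j⟩ := x
  cases j with
  | zero => exact Or.inl ⟨i, rfl⟩
  | succ j => exact Or.inr ⟨i, j, h, rfl⟩

theorem Slots.mk_lt_mk {i i' : Fin s} {j j' : ℕ} {h : j ≤ w i} {h' : j' ≤ w i'} :
    Slots.mk i j h < Slots.mk i' j' h' ↔ i < i' ∨ i = i' ∧ j < j' := by
  rw [← Subtype.coe_lt_coe]
  exact Prod.Lex.toLex_lt_toLex

theorem Slots.mk_congr {i i' : Fin s} {j j' : ℕ} {h : j ≤ w i} {h' : j' ≤ w i'} (h1 : i = i')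
    (h2 : j = j') : Slots.mk i j h = Slots.mk i' j' h' := by
  subst h1 h2; rfl

def Slots.equivSigma : Slots w ≃ Σ i, Fin (w i + 1) where
  toFun x := ⟨(ofLex x.1).1, ⟨(ofLex x.1).2, Nat.lt_succ_of_le x.2⟩⟩
  invFun y := ⟨toLex (y.1, y.2.1), Nat.le_of_lt_succ y.2.2⟩
  left_inv _ := rfl
  right_inv _ := rfl

instance : Fintype (Slots w) := Fintype.ofEquiv _ Slots.equivSigma.symm

theorem Slots.card : Fintype.card (Slots w) = ∑ i, (w i + 1) := by
  rw [Fintype.card_congr Slots.equivSigma]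
  simp

end Slots

section Inflate

variable {s : ℕ} {ρ : Equiv.Perm (Fin s)} {S : Fin s → Inv}

/-- The involution with kernel shape `ρ` and gap contents `S`. -/
noncomputable def inflate (ρ : Equiv.Perm (Fin s)) (hS : Fill ρ S)
    (x : Slots fun i => (S i).1) : Slots fun i => (S i).1 :=
  if h : (ofLex x.1).2 = 0 then Slots.mk (ρ (ofLex x.1).1) 0 (Nat.zero_le _)
  else Slots.mk (mate ρ (ofLex x.1).1) ((S (ofLex x.1).1).app ((ofLex x.1).2 - 1) + 1) (by
    have h1 : (ofLex x.1).2 ≤ (S (ofLex x.1).1).1 := x.2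
    have h2 := (S (ofLex x.1).1).app_lt (j := (ofLex x.1).2 - 1) (by omega)
    rw [hS.mate]
    omega)

theorem inflate_zero (hS : Fill ρ S) (i : Fin s) :
    inflate ρ hS (Slots.mk i 0 (Nat.zero_le _)) = Slots.mk (ρ i) 0 (Nat.zero_le _) := by
  unfold inflate
  exact dif_pos rfl

theorem inflate_succ (hS : Fill ρ S) (i : Fin s) (j : ℕ) (h : j + 1 ≤ (S i).1) :
    inflate ρ hS (Slots.mk i (j + 1) h) = Slots.mk (mate ρ i) ((S i).app j + 1) (by
      have h2 := (S i).app_lt (j := j) (by omega)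
      rw [hS.mate]
      omega) := by
  unfold inflate
  exact dif_neg (Nat.succ_ne_zero j)

theorem inflate_involutive (hρ : Shape ρ) (hS : Fill ρ S) :
    Function.Involutive (inflate ρ hS) := by
  intro x
  rcases x.exists_eq with ⟨i, rfl⟩ | ⟨i, j, h, rfl⟩
  · rw [inflate_zero, inflate_zero]
    exact Slots.mk_congr (hρ.inv.apply_apply i) rfl
  · rw [inflate_succ, inflate_succ]
    refine Slots.mk_congr (hρ.mate_mate i) ?_
    rw [hS.mate, Inv.app_app]

/-- Every admissible choice of contents occurs in an involution. -/
theorem exists_of_fill (hρ : Shape ρ) (hS : Fill ρ S) {n : ℕ} (hn : ∑ i, ((S i).1 + 1) = n) :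
    ∃ (π : Equiv.Perm (Fin n)) (e : Fin s ↪o Fin n), IsInvolution π ∧ Fits ρ π e ∧
      Realizes ρ π e S := by
  let φ : Fin n ≃o Slots (fun i => (S i).1) :=
    Fintype.orderIsoFinOfCardEq _ (Slots.card.trans hn)
  let π : Equiv.Perm (Fin n) := Function.Involutive.toPerm
    (fun x => φ.symm (inflate ρ hS (φ x))) (fun x => by
      simp only [OrderIso.apply_symm_apply, inflate_involutive hρ hS (φ x),
        OrderIso.symm_apply_apply])
  have hπ : ∀ y, π (φ.symm y) = φ.symm (inflate ρ hS y) := fun y => by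
    change φ.symm (inflate ρ hS (φ (φ.symm y))) = _
    rw [OrderIso.apply_symm_apply]
  have hinv : IsInvolution π := isInvolution_iff.2 fun x => by
    obtain ⟨y, rfl⟩ := φ.symm.surjective x
    rw [hπ, hπ, inflate_involutive hρ hS y]
  let e : Fin s ↪o Fin n := OrderEmbedding.ofStrictMono
    (fun i => φ.symm (Slots.mk i 0 (Nat.zero_le _))) (fun i j hij => by
      apply φ.symm.strictMono
      exact Slots.mk_lt_mk.2 (Or.inl hij))
  have he : ∀ i, e i = φ.symm (Slots.mk i 0 (Nat.zero_le _)) := fun i => rfl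
  let g : ∀ i, Fin (S i).1 ↪o Fin n := fun i => OrderEmbedding.ofStrictMono
    (fun j => φ.symm (Slots.mk i (j + 1) j.2)) (fun j k hjk => by
      apply φ.symm.strictMono
      exact Slots.mk_lt_mk.2 (Or.inr ⟨rfl, by rw [Fin.lt_def] at hjk; omega⟩))
  have hg : ∀ i j, g i j = φ.symm (Slots.mk i (j + 1) j.2) := fun i j => rfl
  have hrange : ∀ i, Set.range (g i) = gap e i := by
    intro i
    ext x
    constructor
    · rintro ⟨j, rfl⟩
      rw [hg]
      refine ⟨?_, fun k hk => ?_⟩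
      · rw [he, φ.symm.lt_iff_lt, Slots.mk_lt_mk]
        exact Or.inr ⟨rfl, Nat.succ_pos _⟩
      · rw [he, φ.symm.lt_iff_lt, Slots.mk_lt_mk]
        exact Or.inl hk
    · rintro ⟨h1, h2⟩
      obtain ⟨y, rfl⟩ := φ.symm.surjective x
      rw [he, φ.symm.lt_iff_lt] at h1
      rcases y.exists_eq with ⟨i', rfl⟩ | ⟨i', j, h, rfl⟩
      · rw [Slots.mk_lt_mk] at h1
        have h1 : i < i' := by
          rcases h1 with h1 | h1
          · exact h1
          · exact absurd h1.2 (lt_irrefl _)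
        exact absurd (h2 i' h1) (lt_irrefl _)
      · rw [Slots.mk_lt_mk] at h1
        rcases h1 with h1 | h1
        · have := h2 i' h1
          rw [he, φ.symm.lt_iff_lt, Slots.mk_lt_mk] at this
          rcases this with h | h
          · exact absurd h (lt_irrefl _)
          · exact absurd h.2 (Nat.not_lt_zero _)
        · obtain ⟨rfl, -⟩ := h1
          exact ⟨⟨j, h⟩, rfl⟩
  have hmap : ∀ k, π (e k) = e (ρ k) := fun k => by rw [he, hπ, inflate_zero]; rfl
  have hπg : ∀ i j, π (g i j) = φ.symm (Slots.mk (mate ρ i) ((S i).2.1 j + 1) (by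
      rw [hS.mate]; exact ((S i).2.1 j).2)) := fun i j => by
    rw [hg, hπ, inflate_succ]
    congr 1
    exact Slots.mk_congr rfl (by rw [Inv.app_fin])
  have hreal : Realizes ρ π e S := by
    intro i
    have hm : (S i).1 = (S (mate ρ i)).1 := by rw [hS.mate]
    refine ⟨g i, (Fin.castOrderIso hm).toOrderEmbedding.trans (g (mate ρ i)), hrange i, ?_, ?_⟩
    · rw [← hrange]
      exact (Fin.castOrderIso hm).surjective.range_comp (g (mate ρ i))
    · intro j
      rw [hπg]
      rfl
  refine ⟨π, e, hinv, ⟨hmap, ⟨⟨0, hρ.pos⟩, fun x => ?_⟩, ?_, ?_⟩, hreal⟩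
  · obtain ⟨y, rfl⟩ := φ.symm.surjective x
    rw [he, φ.symm.le_iff_le, ← not_lt]
    intro hlt
    rcases y.exists_eq with ⟨i', rfl⟩ | ⟨i', j, h, rfl⟩
    · rw [Slots.mk_lt_mk] at hlt
      rcases hlt with h | h
      · exact Nat.not_lt_zero _ h
      · exact lt_irrefl _ h.2
    · rw [Slots.mk_lt_mk] at hlt
      rcases hlt with h | h
      · exact Nat.not_lt_zero _ h
      · exact Nat.not_lt_zero _ h.2
  · intro l x hx
    obtain ⟨g', h', h1, h2, h3⟩ := hreal l
    obtain ⟨j, rfl⟩ := h1.symm.subset hx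
    refine ⟨mate ρ l, feasible_mate (hS.live l ?_), ?_⟩
    · exact (Nat.zero_lt_of_lt j.2).ne'
    · rw [h3]
      exact h2.subset ⟨_, rfl⟩
  · intro m l hd x hx y hy hxy
    rw [mem_cell_iff hmap] at hx hy
    obtain ⟨j, rfl⟩ := (hrange l).symm.subset hx.1
    obtain ⟨k, rfl⟩ := (hrange l).symm.subset hy.1
    have hml : mate ρ l = m := by
      refine gap_unique ?_ hx.2
      obtain ⟨g', h', h1, h2, h3⟩ := hreal l
      obtain ⟨j', hj'⟩ := h1.symm.subset hx.1
      rw [← hj', h3]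
      exact h2.subset ⟨_, rfl⟩
    have hrev := hS.dec l (hml.symm ▸ hd)
    have hjk : j < k := (g l).lt_iff_lt.1 hxy
    rw [hπg, hπg, φ.symm.lt_iff_lt, Slots.mk_lt_mk]
    refine Or.inr ⟨rfl, ?_⟩
    have hval : ∀ (x : Inv), x = Inv.rev x.1 → ∀ j k : Fin x.1, j < k →
        (x.2.1 k : ℕ) < x.2.1 j := by
      rintro ⟨n, σ, hσ⟩ hx j k hjk
      simp only [Inv.rev, Sigma.mk.injEq, heq_eq_eq, true_and, Subtype.mk.injEq] at hx
      subst hx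
      simp only [Fin.revPerm_apply, Fin.val_fin_lt, Fin.rev_lt_rev]
      exact hjk
    exact Nat.succ_lt_succ (hval _ hrev j k hjk)

end Inflate

/-! ### Counting the involutions of a given kernel shape -/

section Count

variable {s : ℕ} {ρ : Equiv.Perm (Fin s)} {S : Fin s → Inv} {n : ℕ} {π : Equiv.Perm (Fin n)}
  {e : Fin s ↪o Fin n}

theorem Realizes.card_eq (hF : Fits ρ π e) (h : Realizes ρ π e S) :
    ∑ i, ((S i).1 + 1) = n := by
  have hsplit : (Set.univ : Set (Fin n)) = Set.range e ∪ ⋃ i, gap e i := by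
    refine Set.Subset.antisymm (fun x _ => ?_) (Set.subset_univ _)
    by_cases hx : x ∈ Set.range e
    · exact Or.inl hx
    · exact Or.inr (Set.mem_iUnion.2 (exists_mem_gap hF.bot hx))
  have hu : (Set.univ : Set (Fin n)).ncard = n := by rw [Set.ncard_univ]; simp
  rw [hsplit, Set.ncard_union_eq ?_ (Set.toFinite _) (Set.toFinite _), ncard_range_emb,
    Set.ncard_iUnion_of_finite, finsum_eq_sum_of_fintype] at hu
  · rw [Finset.sum_add_distrib]
    simp only [Finset.sum_const, Finset.card_univ, Fintype.card_fin, smul_eq_mul, mul_one]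
    rw [add_comm]
    refine Eq.trans ?_ hu
    congr 1
    refine Finset.sum_congr rfl fun i _ => ?_
    obtain ⟨g, -, h1, -⟩ := h i
    have := ncard_range_emb g
    rw [h1] at this
    exact this.symm
  · exact fun i => Set.toFinite _
  · intro i j hij
    rw [Function.onFun, Set.disjoint_left]
    exact fun x hx hx' => hij (gap_unique hx hx')
  · rw [Set.disjoint_left]
    intro x hx hx'
    obtain ⟨l, hl⟩ := Set.mem_iUnion.1 hx'
    exact notMem_range_of_mem_gap hl hx

open Classical in
theorem Realizes.numOcc_eq (hρ : Shape ρ) (hinv : IsInvolution π) (hn : 0 < n)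
    (hF : Fits ρ π e) (h : Realizes ρ π e S) :
    numOcc π = numOcc ρ + ∑ i, if mate ρ i = i then numOcc (S i).2.1 else 0 := by
  obtain ⟨h1, h2⟩ := (hF.isKernel hρ hinv).numOcc_eq hinv hn
  rw [h1]
  congr 1
  refine Finset.sum_congr rfl fun i _ => ?_
  obtain ⟨g, k, e1, e2, e3⟩ := h i
  split_ifs with hi
  · have hgk : g = k := emb_eq_of_range (by rw [e1, e2, hi])
    subst hgk
    rw [← e1, numOcc_eq_ncard]
    exact ncard_occIn_range g.strictMono e3
  -- The images of an occurrence within a gap lie in the same gap, so a gap with a different mate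
  -- contains none.
  · rw [Set.ncard_eq_zero (Set.toFinite _), Set.eq_empty_iff_forall_notMem]
    rintro ⟨a, b, c, d⟩ ⟨hO, ha, hb, hc, hd⟩
    exact hi (gap_unique (hF.map_gap hρ hc) (h2 i a b c d hO ha hb hc hd))

open Classical in
/-- Involutions with the kernel shape `ρ` correspond to the contents of its gaps. -/
theorem card_shape (hρ : Shape ρ) (n r : ℕ) :
    Nat.card {π : Equiv.Perm (Fin n) //
      IsInvolution π ∧ (∃ e : Fin s ↪o Fin n, IsKernel ρ π e) ∧ numOcc π = r} =
    Nat.card {S : Fin s → Inv // Fill ρ S ∧ ∑ i, ((S i).1 + 1) = n ∧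
      numOcc ρ + ∑ i, (if mate ρ i = i then numOcc (S i).2.1 else 0) = r} := by
  symm
  have hex : ∀ S : {S : Fin s → Inv // Fill ρ S ∧ ∑ i, ((S i).1 + 1) = n ∧
      numOcc ρ + ∑ i, (if mate ρ i = i then numOcc (S i).2.1 else 0) = r},
      ∃ (π : Equiv.Perm (Fin n)) (e : Fin s ↪o Fin n), IsInvolution π ∧ Fits ρ π e ∧
        Realizes ρ π e S.1 := fun S => exists_of_fill hρ S.2.1 S.2.2.1
  choose π e hinv hF hR using hex
  refine Nat.card_congr (Equiv.ofBijective (fun S => ⟨π S, hinv S,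
    ⟨e S, (hF S).isKernel hρ (hinv S)⟩, ?_⟩) ⟨?_, ?_⟩)
  · rw [(hR S).numOcc_eq hρ (hinv S) (e S ⟨0, hρ.pos⟩).pos (hF S)]
    exact S.2.2.2
  · intro S S' h
    have hπ : π S = π S' := congrArg Subtype.val h
    have hee : e S = e S' := ((hF S).isKernel hρ (hinv S)).emb_unique
      (hπ ▸ (hF S').isKernel hρ (hinv S'))
    apply Subtype.ext
    have := hR S'
    rw [← hπ, ← hee] at this
    exact (hR S).unique this
  · rintro ⟨π', hinv', ⟨e', hK⟩, hr⟩
    have hn : 0 < n := (e' ⟨0, hρ.pos⟩).pos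
    have hF' := hK.fits hinv' hn
    obtain ⟨S, hfill, hreal⟩ := hF'.exists_realizes hρ hinv'
    refine ⟨⟨S, hfill, hreal.card_eq hF', ?_⟩, ?_⟩
    · rw [← hr, hreal.numOcc_eq hρ hinv' hn hF']
    · apply Subtype.ext
      exact (hR _).perm_unique hreal (hF _) hF'

/-- The contents of the `i`-th gap that are recorded: those of gaps in feasible cells on or above
the diagonal. -/
def contents (ρ : Equiv.Perm (Fin s)) (i : Fin s) : Set Inv :=
  {x | (x.1 ≠ 0 → Live ρ i ∧ i ≤ mate ρ i) ∧
    (AlwaysDecreasing ρ (mate ρ i) i → x = Inv.rev x.1)}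

theorem Inv.eq_rev_zero {x : Inv} (h : x.1 = 0) : x = Inv.rev 0 := by
  obtain ⟨n, σ, hσ⟩ := x
  dsimp only at h
  subst h
  simp only [Inv.rev, Sigma.mk.injEq, heq_eq_eq, true_and, Subtype.mk.injEq]
  ext i
  exact i.elim0

/-- Contents of the gaps are determined by those on or above the diagonal. -/
noncomputable def fillEquiv (hρ : Shape ρ) :
    {S : Fin s → Inv // Fill ρ S} ≃ ∀ i, contents ρ i where
  -- Gaps below the diagonal record the empty involution, so that mated gaps are not counted twice.
  toFun S i := ⟨if i ≤ mate ρ i then S.1 i else Inv.rev 0, by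
    split_ifs with h
    · exact ⟨fun h0 => ⟨S.2.live i h0, h⟩, S.2.dec i⟩
    · exact ⟨fun h0 => absurd rfl h0, fun _ => rfl⟩⟩
  invFun D := ⟨fun i => if i ≤ mate ρ i then (D i).1 else (D (mate ρ i)).1, by
    constructor
    · intro i
      rw [hρ.mate_mate]
      rcases lt_trichotomy i (mate ρ i) with h | h | h
      · rw [if_neg (not_le.2 h), if_pos h.le]
      · rw [← h]
      · rw [if_pos h.le, if_neg (not_le.2 h)]
    · intro i
      split_ifs with h
      · exact fun h0 => ((D i).2.1 h0).1
      · intro h0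
        have := live_mate ((D (mate ρ i)).2.1 h0).1
        rwa [hρ.mate_mate] at this
    · intro i hd
      split_ifs with h
      · exact (D i).2.2 hd
      · refine (D (mate ρ i)).2.2 (Shape.alwaysDecreasing_of_ne ?_)
        rw [hρ.mate_mate]
        exact (not_le.1 h).ne'⟩
  left_inv S := by
    apply Subtype.ext
    funext i
    dsimp only
    split_ifs with h h'
    · rfl
    · exact S.2.mate i
    · rw [hρ.mate_mate] at h'
      exact absurd (not_le.1 h).le h'
  right_inv D := by
    funext i
    apply Subtype.ext
    dsimp only
    split_ifs with h
    · rfl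
    · refine (Inv.eq_rev_zero ?_).symm
      by_contra h0
      exact h ((D i).2.1 h0).2

/-- The number of entries of the involution that an entry of the recorded contents stands for. -/
noncomputable def mult (ρ : Equiv.Perm (Fin s)) (i : Fin s) : ℕ := if i < mate ρ i then 2 else 1

theorem sum_fillEquiv_symm (hρ : Shape ρ) (D : ∀ i, contents ρ i) :
    ∑ i, (((fillEquiv hρ).symm D).1 i).1 = ∑ i, mult ρ i * (D i).1.1 := by
  have hmate : Function.Involutive (mate ρ) := hρ.mate_mate
  have h1 : ∀ i, (((fillEquiv hρ).symm D).1 i).1 =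
      (if i ≤ mate ρ i then (D i).1.1 else 0) +
        (if mate ρ i < mate ρ (mate ρ i) then (D (mate ρ i)).1.1 else 0) := by
    intro i
    rw [hρ.mate_mate]
    change (if i ≤ mate ρ i then (D i).1 else (D (mate ρ i)).1).1 = _
    split_ifs with h h' h'
    · exact absurd h (not_le.2 h')
    · simp
    · simp
    · exact absurd (not_le.1 h) h'
  have h2 : ∑ i, (if mate ρ i < mate ρ (mate ρ i) then (D (mate ρ i)).1.1 else 0) =
      ∑ i, (if i < mate ρ i then (D i).1.1 else 0) :=
    Equiv.sum_comp hmate.toPerm (fun i => if i < mate ρ i then (D i).1.1 else 0)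
  rw [Finset.sum_congr rfl fun i _ => h1 i, Finset.sum_add_distrib, h2, ← Finset.sum_add_distrib]
  refine Finset.sum_congr rfl fun i _ => ?_
  unfold mult
  rcases lt_trichotomy i (mate ρ i) with h | h | h
  · rw [if_pos h.le, if_pos h, if_pos h]
    ring
  · rw [if_pos h.le, if_neg h.not_lt, if_neg h.not_lt]
    ring
  · rw [if_neg (not_le.2 h), if_neg h.not_gt, if_neg h.not_gt]
    have : (D i).1.1 = 0 := by
      by_contra h0
      exact absurd ((D i).2.1 h0).2 (not_le.2 h)
    rw [this]

open Classical in
theorem card_shape_contents (hρ : Shape ρ) (n r : ℕ) :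
    Nat.card {π : Equiv.Perm (Fin n) //
      IsInvolution π ∧ (∃ e : Fin s ↪o Fin n, IsKernel ρ π e) ∧ numOcc π = r} =
    Nat.card {D : ∀ i, contents ρ i // s + ∑ i, mult ρ i * (D i).1.1 = n ∧
      numOcc ρ + ∑ i, (if mate ρ i = i then numOcc (D i).1.2.1 else 0) = r} := by
  rw [card_shape hρ]
  refine Nat.card_congr ((Equiv.subtypeSubtypeEquivSubtypeInter (Fill ρ) _).symm.trans
    ((fillEquiv hρ).subtypeEquiv fun S => ?_))
  obtain ⟨D, rfl⟩ := (fillEquiv hρ).symm.surjective S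
  rw [Equiv.apply_symm_apply, ← sum_fillEquiv_symm hρ D, Finset.sum_add_distrib]
  have h1 : ∀ i, (if mate ρ i = i then numOcc (((fillEquiv hρ).symm D).1 i).2.1 else 0) =
      (if mate ρ i = i then numOcc (D i).1.2.1 else 0) := by
    intro i
    split_ifs with h
    · change numOcc (if i ≤ mate ρ i then (D i).1 else (D (mate ρ i)).1).2.1 = _
      rw [if_pos h.ge]
    · rfl
  rw [Finset.sum_congr rfl fun i _ => h1 i]
  simp only [Finset.sum_const, Finset.card_univ, Fintype.card_fin, smul_eq_mul, mul_one]
  rw [add_comm]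

end Count

/-! ### Generating functions by size and number of occurrences -/

section BivariateGF

open PowerSeries

theorem card_eq_sum_fiber {X Y : Type*} [Finite X] (g : X → Y) (T : Finset Y)
    (h : ∀ x, g x ∈ T) : Nat.card X = ∑ y ∈ T, Nat.card {x // g x = y} := by
  classical
  cases nonempty_fintype X
  simp only [Nat.card_eq_fintype_card, Fintype.card_subtype]
  rw [← Finset.card_univ]
  exact Finset.card_eq_sum_card_fiberwise fun x _ => h x

/-- The number of elements of given size and weight. -/
noncomputable def fiberCard {A : Type*} (sz oc : A → ℕ) (n k : ℕ) : ℕ :=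
  Nat.card {a : A // sz a = n ∧ oc a = k}

/-- The generating function of a type graded by two statistics. -/
noncomputable def bgf {A : Type*} (sz oc : A → ℕ) : PowerSeries (PowerSeries ℚ) :=
  PowerSeries.mk fun k => PowerSeries.mk fun n => (fiberCard sz oc n k : ℚ)

theorem coeff_bgf {A : Type*} (sz oc : A → ℕ) (n k : ℕ) :
    coeff n (coeff k (bgf sz oc)) = (fiberCard sz oc n k : ℚ) := by
  simp [bgf]

theorem bgf_congr {A B : Type*} {sz oc : A → ℕ} {sz' oc' : B → ℕ} (φ : A ≃ B)
    (h1 : ∀ a, sz' (φ a) = sz a) (h2 : ∀ a, oc' (φ a) = oc a) : bgf sz oc = bgf sz' oc' := by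
  ext k n
  rw [coeff_bgf, coeff_bgf]
  congr 1
  exact Nat.card_congr (φ.subtypeEquiv fun a => by rw [h1, h2])

/-- There are finitely many elements of bounded size. -/
def FinFib {A : Type*} (sz : A → ℕ) : Prop := ∀ n, {a | sz a ≤ n}.Finite

theorem FinFib.finite {A : Type*} {sz : A → ℕ} (h : FinFib sz) (oc : A → ℕ) (n k : ℕ) :
    Finite {a : A // sz a = n ∧ oc a = k} :=
  ((h n).subset fun _ ha => ha.1.le : {a : A | sz a = n ∧ oc a = k}.Finite).to_subtype

theorem FinFib.prod {A B : Type*} {sz : A → ℕ} {sz' : B → ℕ} (h : FinFib sz) (h' : FinFib sz') :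
    FinFib fun x : A × B => sz x.1 + sz' x.2 := fun n =>
  ((h n).prod (h' n)).subset fun _ hx =>
    ⟨(Nat.le_add_right _ _).trans hx, (Nat.le_add_left _ _).trans hx⟩

/-- Pairs are sorted by both statistics of both components. Finite fibres keep `Nat.card` additive
over this partition. -/
theorem bgf_prod {A B : Type*} {sz oc : A → ℕ} {sz' oc' : B → ℕ} (h : FinFib sz)
    (h' : FinFib sz') : bgf (fun x : A × B => sz x.1 + sz' x.2) (fun x => oc x.1 + oc' x.2) =
      bgf sz oc * bgf sz' oc' := by
  ext k n
  rw [coeff_bgf, coeff_mul, map_sum]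
  have := (h.prod h').finite (fun x => oc x.1 + oc' x.2) n k
  rw [fiberCard, card_eq_sum_fiber
    (fun x : {x : A × B // sz x.1 + sz' x.2 = n ∧ oc x.1 + oc' x.2 = k} =>
      ((oc x.1.1, oc' x.1.2), (sz x.1.1, sz' x.1.2)))
    (Finset.HasAntidiagonal.antidiagonal k ×ˢ Finset.HasAntidiagonal.antidiagonal n) (fun x => by
      rw [Finset.mem_product, Finset.HasAntidiagonal.mem_antidiagonal,
        Finset.HasAntidiagonal.mem_antidiagonal]
      exact ⟨x.2.2, x.2.1⟩), Finset.sum_product, Nat.cast_sum]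
  refine Finset.sum_congr rfl fun p hp => ?_
  rw [coeff_mul, Nat.cast_sum]
  refine Finset.sum_congr rfl fun q hq => ?_
  rw [coeff_bgf, coeff_bgf, fiberCard, fiberCard, ← Nat.cast_mul, ← Nat.card_prod]
  congr 1
  rw [Finset.HasAntidiagonal.mem_antidiagonal] at hp hq
  refine Nat.card_congr
    { toFun := fun x => (⟨x.1.1.1, ?_⟩, ⟨x.1.1.2, ?_⟩)
      invFun := fun y => ⟨⟨(y.1.1, y.2.1), ?_⟩, ?_⟩
      left_inv := fun _ => rfl
      right_inv := fun _ => rfl }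
  · have := x.2
    simp only [Prod.ext_iff] at this
    exact ⟨this.2.1, this.1.1⟩
  · have := x.2
    simp only [Prod.ext_iff] at this
    exact ⟨this.2.2, this.1.2⟩
  · exact ⟨by rw [y.1.2.1, y.2.2.1, hq], by rw [y.1.2.2, y.2.2.2, hp]⟩
  · exact Prod.ext (Prod.ext y.1.2.2 y.2.2.2) (Prod.ext y.1.2.1 y.2.2.1)

theorem finFib_and_bgf_pi {s : ℕ} {A : Fin s → Type*} (sz oc : ∀ i, A i → ℕ)
    (h : ∀ i, FinFib (sz i)) : FinFib (fun D : ∀ i, A i => ∑ i, sz i (D i)) ∧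
      bgf (fun D : ∀ i, A i => ∑ i, sz i (D i)) (fun D => ∑ i, oc i (D i)) =
        ∏ i, bgf (sz i) (oc i) := by
  induction s with
  | zero =>
    refine ⟨fun n => Set.toFinite _, ?_⟩
    ext k n
    rw [coeff_bgf, Finset.univ_eq_empty, Finset.prod_empty, coeff_one, fiberCard]
    simp only [Finset.sum_empty]
    by_cases hk : k = 0
    · rw [if_pos hk, coeff_one]
      by_cases hn : n = 0
      · subst hk hn
        simp
      · have : IsEmpty {a : ∀ i, A i // 0 = n ∧ 0 = k} := ⟨fun a => hn a.2.1.symm⟩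
        simp [hn]
    · have : IsEmpty {a : ∀ i, A i // 0 = n ∧ 0 = k} := ⟨fun a => hk a.2.2.symm⟩
      simp [hk]
  | succ s ih =>
    obtain ⟨ih1, ih2⟩ := ih (fun i => sz i.succ) (fun i => oc i.succ) fun i => h i.succ
    constructor
    · intro n
      have := (h 0).prod ih1 n
      refine (this.image (Fin.consEquiv A)).subset fun D hD => ?_
      refine ⟨(Fin.consEquiv A).symm D, ?_, Equiv.apply_symm_apply _ _⟩
      have hD : ∑ i, sz i (D i) ≤ n := hD
      rw [Fin.sum_univ_succ] at hD
      exact hD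
    · rw [Fin.prod_univ_succ, ← ih2, ← bgf_prod (h 0) ih1]
      refine bgf_congr (Fin.consEquiv A).symm (fun D => ?_) (fun D => ?_)
      · rw [Fin.sum_univ_succ]
        rfl
      · rw [Fin.sum_univ_succ]
        rfl

end BivariateGF

/-! ### Contributions of single cells -/

section Factors

open PowerSeries

theorem finFib_inv : FinFib (fun x : Inv => x.1) := by
  intro n
  have : {x : Inv | x.1 ≤ n} = ⋃ m ∈ Finset.range (n + 1),
      (fun σ => (⟨m, σ⟩ : Inv)) '' Set.univ := by
    ext ⟨m, σ⟩
    simp only [Set.mem_ofPred_eq, Finset.mem_range, Set.image_univ, Set.mem_iUnion, Set.mem_range]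
    refine ⟨fun h => ⟨m, Nat.lt_succ_of_le h, σ, rfl⟩, ?_⟩
    rintro ⟨m', h, σ', heq⟩
    have : m' = m := congrArg Sigma.fst heq
    omega
  rw [this]
  exact Set.Finite.biUnion (Finset.finite_toSet _) fun m _ => Set.toFinite _

/-- The outer variable marks occurrences, the inner one length; a free cell thus contributes the
series with coefficients I_k(x). -/
theorem bgf_inv : bgf (fun x : Inv => x.1) (fun x => numOcc x.2.1) = PowerSeries.mk invGF := by
  ext k n
  rw [coeff_bgf, coeff_mk, invGF, coeff_mk, fiberCard]
  congr 1
  refine Nat.card_congr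
    { toFun := fun x => ⟨(x.2.1 ▸ x.1.2 : {σ : Equiv.Perm (Fin n) // IsInvolution σ}).1, ?_⟩
      invFun := fun σ => ⟨⟨n, σ.1, σ.2.1⟩, rfl, σ.2.2⟩
      left_inv := ?_
      right_inv := fun _ => rfl }
  · obtain ⟨⟨m, σ, hσ⟩, rfl, h⟩ := x
    exact ⟨hσ, h⟩
  · rintro ⟨⟨m, σ, hσ⟩, rfl, h⟩
    rfl

theorem numOcc_rev (n : ℕ) : numOcc (Fin.revPerm : Equiv.Perm (Fin n)) = 0 := by
  rw [numOcc_eq_ncard, Set.ncard_eq_zero (Set.toFinite _), Set.eq_empty_iff_forall_notMem]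
  rintro ⟨a, b, c, d⟩ ⟨⟨h1, -, -, -, -, h6⟩, -⟩
  rw [Fin.revPerm_apply, Fin.revPerm_apply, Fin.rev_lt_rev] at h6
  exact lt_asymm h1 h6

/-- The elements of size `c * k`, one for each `k`, contribute a geometric series. -/
theorem bgf_mul_nat {c : ℕ} (hc : 0 < c) :
    bgf (fun k : ℕ => c * k) (fun _ => 0) = C (1 - X ^ c : PowerSeries ℚ)⁻¹ := by
  have hgeo : (PowerSeries.mk fun n => (if c ∣ n then 1 else 0 : ℚ)) =
      (1 - X ^ c : PowerSeries ℚ)⁻¹ := by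
    rw [PowerSeries.eq_inv_iff_mul_eq_one (by simp [hc.ne'])]
    ext n
    rw [mul_sub, mul_one, map_sub, coeff_mk, coeff_mul_X_pow', coeff_one]
    by_cases hn : c ≤ n
    · rw [if_pos hn, coeff_mk, if_neg (by omega : n ≠ 0)]
      have : c ∣ n - c ↔ c ∣ n :=
        ⟨fun h => by simpa [Nat.sub_add_cancel hn] using Nat.dvd_add h (dvd_refl c),
          fun h => Nat.dvd_sub h dvd_rfl⟩
      simp only [this, sub_self]
    · rw [if_neg hn, sub_zero]
      by_cases h0 : n = 0
      · simp [h0]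
      · rw [if_neg h0, if_neg (fun h => hn (Nat.le_of_dvd (by omega) h))]
  rw [← hgeo]
  ext k n
  rw [coeff_bgf, coeff_C, fiberCard]
  by_cases hk : k = 0
  · rw [if_pos hk, coeff_mk]
    by_cases hn : c ∣ n
    · rw [if_pos hn]
      obtain ⟨m, rfl⟩ := hn
      have : Unique {a : ℕ // c * a = c * m ∧ 0 = k} :=
        ⟨⟨⟨m, rfl, hk.symm⟩⟩, fun a => Subtype.ext (Nat.eq_of_mul_eq_mul_left hc a.2.1)⟩
      rw [Nat.card_unique, Nat.cast_one]
    · rw [if_neg hn]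
      have : IsEmpty {a : ℕ // c * a = n ∧ 0 = k} := ⟨fun a => hn ⟨a.1, a.2.1.symm⟩⟩
      simp
  · rw [if_neg hk]
    have : IsEmpty {a : ℕ // c * a = n ∧ 0 = k} := ⟨fun a => hk a.2.2.symm⟩
    simp

theorem bgf_unique {A : Type*} [Unique A] {sz oc : A → ℕ} (h1 : sz default = 0)
    (h2 : oc default = 0) : bgf sz oc = 1 := by
  ext k n
  rw [coeff_bgf, coeff_one, fiberCard]
  by_cases hk : k = 0
  · rw [if_pos hk, coeff_one]
    by_cases hn : n = 0
    · rw [if_pos hn]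
      have : Unique {a : A // sz a = n ∧ oc a = k} :=
        ⟨⟨⟨default, h1.trans hn.symm, h2.trans hk.symm⟩⟩, fun a =>
          Subtype.ext (Subsingleton.elim _ _)⟩
      rw [Nat.card_unique, Nat.cast_one]
    · rw [if_neg hn]
      have : IsEmpty {a : A // sz a = n ∧ oc a = k} :=
        ⟨fun a => hn (by rw [← a.2.1, Subsingleton.elim a.1 default, h1])⟩
      simp
  · rw [if_neg hk]
    have : IsEmpty {a : A // sz a = n ∧ oc a = k} :=
      ⟨fun a => hk (by rw [← a.2.2, Subsingleton.elim a.1 default, h2])⟩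
    simp

end Factors

/-! ### Generating function of a shape -/

section Shapes

open PowerSeries

variable {s : ℕ} {ρ : Equiv.Perm (Fin s)}

/-- A live column has exactly one feasible cell, in the row of its mate, so cells can be counted by
columns. -/
theorem ncard_cells (hρ : Shape ρ) (P : Fin s → Fin s → Prop)
    [DecidablePred fun i => Live ρ i ∧ P (mate ρ i) i] :
    {c : Fin s × Fin s | ¬ Infeasible ρ c.1 c.2 ∧ P c.1 c.2}.ncard =
      (Finset.univ.filter fun i => Live ρ i ∧ P (mate ρ i) i).card := by
  rw [← Set.ncard_coe_finset]
  have : {c : Fin s × Fin s | ¬ Infeasible ρ c.1 c.2 ∧ P c.1 c.2} =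
      (fun i => (mate ρ i, i)) '' (Finset.univ.filter fun i => Live ρ i ∧ P (mate ρ i) i) := by
    ext ⟨m, l⟩
    simp only [Set.mem_ofPred_eq, Set.mem_image, Finset.coe_filter, Finset.mem_univ, true_and,
      Prod.mk.injEq]
    constructor
    · rintro ⟨h1, h2⟩
      have hm := hρ.mate_eq h1
      exact ⟨l, ⟨⟨m, h1⟩, by rwa [hm]⟩, hm, rfl⟩
    · rintro ⟨i, ⟨h1, h2⟩, rfl, rfl⟩
      exact ⟨feasible_mate h1, h2⟩
  rw [this, Set.ncard_image_of_injective _ fun i j h => (Prod.ext_iff.1 h).2]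

theorem finFib_contents (i : Fin s) : FinFib fun x : contents ρ i => mult ρ i * x.1.1 := by
  intro n
  refine Set.Finite.of_finite_image ((finFib_inv n).subset ?_) Subtype.val_injective.injOn
  rintro _ ⟨x, hx, rfl⟩
  have hx : mult ρ i * x.1.1 ≤ n := hx
  refine le_trans ?_ hx
  have : 0 < mult ρ i := by
    unfold mult
    split_ifs <;> omega
  exact Nat.le_mul_of_pos_left _ this

theorem bgf_rev {i : Fin s} (hl : Live ρ i) (hle : i ≤ mate ρ i)
    (hd : AlwaysDecreasing ρ (mate ρ i) i) {oc : contents ρ i → ℕ}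
    (hoc : ∀ n (h : Inv.rev n ∈ contents ρ i), oc ⟨Inv.rev n, h⟩ = 0) :
    bgf (fun x : contents ρ i => mult ρ i * x.1.1) oc =
      C (1 - X ^ mult ρ i : PowerSeries ℚ)⁻¹ := by
  have hpos : 0 < mult ρ i := by
    unfold mult
    split_ifs <;> omega
  have hmem : ∀ n, Inv.rev n ∈ contents ρ i := fun n => ⟨fun _ => ⟨hl, hle⟩, fun _ => rfl⟩
  rw [← bgf_mul_nat hpos]
  symm
  refine bgf_congr
    { toFun := fun n => ⟨Inv.rev n, hmem n⟩
      invFun := fun x => x.1.1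
      left_inv := fun n => rfl
      right_inv := fun x => Subtype.ext (x.2.2 hd).symm } (fun n => rfl) fun n => hoc n (hmem n)

-- At most one factor differs from 1. A free cell is diagonal because all others decrease, and a
-- column that is not live or whose cell is below the diagonal records only the empty involution.
open Classical in
theorem bgf_contents (ρ : Equiv.Perm (Fin s)) (i : Fin s) :
    bgf (fun x : contents ρ i => mult ρ i * x.1.1)
      (fun x => if mate ρ i = i then numOcc x.1.2.1 else 0) =
    (if Live ρ i ∧ i < mate ρ i ∧ AlwaysDecreasing ρ (mate ρ i) i
        then C (1 - X ^ 2 : PowerSeries ℚ)⁻¹ else 1) *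
      (if Live ρ i ∧ mate ρ i = i ∧ AlwaysDecreasing ρ (mate ρ i) i
        then C (1 - X : PowerSeries ℚ)⁻¹ else 1) *
      (if Live ρ i ∧ ¬ AlwaysDecreasing ρ (mate ρ i) i then PowerSeries.mk invGF else 1) := by
  by_cases hl : Live ρ i ∧ i ≤ mate ρ i
  · obtain ⟨hl, hle⟩ := hl
    rcases hle.lt_or_eq with hlt | heq
    · have hd : AlwaysDecreasing ρ (mate ρ i) i := Shape.alwaysDecreasing_of_ne hlt.ne'
      rw [if_pos ⟨hl, hlt, hd⟩, if_neg (fun h => hlt.ne' h.2.1), if_neg (fun h => h.2 hd),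
        mul_one, mul_one, bgf_rev hl hle hd fun n h => if_neg hlt.ne', mult, if_pos hlt]
    · have hm := heq.symm
      rw [if_neg (fun h => h.2.1.ne heq), one_mul]
      have h1 : mult ρ i = 1 := by rw [mult, if_neg heq.not_lt]
      by_cases hd : AlwaysDecreasing ρ (mate ρ i) i
      · rw [if_pos ⟨hl, hm, hd⟩, if_neg (fun h => h.2 hd), mul_one, bgf_rev hl hle hd, h1, pow_one]
        intro n h
        rw [if_pos hm]
        exact numOcc_rev n
      · rw [if_neg (fun h => hd h.2.2), if_pos ⟨hl, hd⟩, one_mul, ← bgf_inv]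
        exact bgf_congr (Equiv.subtypeUnivEquiv fun x => ⟨fun _ => ⟨hl, hle⟩, fun h => absurd h hd⟩)
          (fun x => by rw [h1, one_mul]; rfl) fun x => by rw [if_pos hm]; rfl
  · have h0 : ∀ x : contents ρ i, x.1 = Inv.rev 0 := fun x =>
      Inv.eq_rev_zero (not_not.1 fun h => hl (x.2.1 h))
    let _ : Unique (contents ρ i) :=
      ⟨⟨⟨Inv.rev 0, fun h => absurd rfl h, fun _ => rfl⟩⟩, fun x => Subtype.ext (h0 x)⟩
    rw [if_neg (fun h => hl ⟨h.1, h.2.1.le⟩), if_neg (fun h => hl ⟨h.1, h.2.1.ge⟩), if_neg,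
      mul_one, mul_one, bgf_unique rfl]
    · rw [h0 default]
      split_ifs
      · exact numOcc_rev 0
      · rfl
    · rintro ⟨h1, h2⟩
      refine h2 (Shape.alwaysDecreasing_of_ne fun h => hl ⟨h1, h.ge⟩)

/-- The generating function of the fillings of the cells of a shape. -/
theorem bgf_shape (hρ : Shape ρ) :
    bgf (fun D : ∀ i, contents ρ i => ∑ i, mult ρ i * (D i).1.1)
      (fun D => ∑ i, (open Classical in if mate ρ i = i then numOcc (D i).1.2.1 else 0)) =
    C ((1 - X ^ 2 : PowerSeries ℚ) ^ d ρ * (1 - X) ^ dd ρ)⁻¹ * (PowerSeries.mk invGF) ^ f ρ := by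
  classical
  have key := (finFib_and_bgf_pi (A := fun i => contents ρ i) (fun i x => mult ρ i * x.1.1)
    (fun i x => if mate ρ i = i then numOcc x.1.2.1 else 0) finFib_contents).2
  refine Eq.trans ?_ (key.trans ?_)
  · congr!
  have hd : d ρ = (Finset.univ.filter fun i =>
      Live ρ i ∧ i < mate ρ i ∧ AlwaysDecreasing ρ (mate ρ i) i).card :=
    ncard_cells hρ fun m l => l < m ∧ AlwaysDecreasing ρ m l
  have hdd : dd ρ = (Finset.univ.filter fun i =>
      Live ρ i ∧ mate ρ i = i ∧ AlwaysDecreasing ρ (mate ρ i) i).card :=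
    ncard_cells hρ fun m l => m = l ∧ AlwaysDecreasing ρ m l
  have hf : f ρ = (Finset.univ.filter fun i =>
      Live ρ i ∧ ¬ AlwaysDecreasing ρ (mate ρ i) i).card :=
    ncard_cells hρ fun m l => ¬ AlwaysDecreasing ρ m l
  have hprod : ∀ (p : Fin s → Prop) [DecidablePred p] (a : PowerSeries (PowerSeries ℚ)),
      ∏ i, (if p i then a else 1) = a ^ (Finset.univ.filter p).card := by
    intro p _ a
    rw [Finset.prod_ite, Finset.prod_const, Finset.prod_const_one, mul_one]
  rw [Finset.prod_congr rfl fun i _ => bgf_contents ρ i, Finset.prod_mul_distrib,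
    Finset.prod_mul_distrib, hprod, hprod, hprod, ← hd, ← hdd, ← hf, ← map_pow, ← map_pow,
    ← map_mul]
  congr 2
  have hinv : ∀ (a : PowerSeries ℚ), constantCoeff a = 1 → ∀ k, a⁻¹ ^ k = (a ^ k)⁻¹ := by
    intro a ha k
    rw [PowerSeries.eq_inv_iff_mul_eq_one (by simp [ha]), ← mul_pow,
      PowerSeries.inv_mul_cancel _ (by simp [ha]), one_pow]
  rw [hinv _ (by simp), hinv _ (by simp), PowerSeries.mul_inv_rev, mul_comm]

theorem coeff_mk_pow (g : ℕ → PowerSeries ℚ) (k m : ℕ) :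
    coeff m ((PowerSeries.mk g) ^ k) = ∑ q ∈ Finset.Nat.antidiagonalTuple k m, ∏ j, g (q j) := by
  have h : (PowerSeries.mk g) ^ k = ∏ _j : Fin k, PowerSeries.mk g := by simp
  rw [h, coeff_prod]
  refine Finset.sum_bij' (fun q _ => ⇑q) (fun q _ => Finsupp.equivFunOnFinite.symm q)
    ?_ ?_ ?_ ?_ ?_
  · intro q hq
    rw [Finset.mem_finsuppAntidiag] at hq
    exact Finset.Nat.mem_antidiagonalTuple.2 hq.1
  · intro q hq
    rw [Finset.mem_finsuppAntidiag]
    exact ⟨Finset.Nat.mem_antidiagonalTuple.1 hq, Finset.subset_univ _⟩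
  · intro q _
    exact Finsupp.equivFunOnFinite.symm_apply_apply q
  · intro q _
    rfl
  · intro q _
    simp

/-- The occurrences inside the kernel use up `numOcc ρ` of the `r`, so the outer coefficient of
degree `r - numOcc ρ` is extracted. The factor `X ^ s` accounts for the kernel entries. -/
theorem card_shape_eq_coeff (hρ : Shape ρ) (n r : ℕ) :
    (Nat.card {π : Equiv.Perm (Fin n) //
      IsInvolution π ∧ (∃ e : Fin s ↪o Fin n, IsKernel ρ π e) ∧ numOcc π = r} : ℚ) =
    coeff n (X ^ s * ((1 - X ^ 2) ^ d ρ * (1 - X) ^ dd ρ)⁻¹ * compSum (f ρ) r (numOcc ρ)) := by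
  classical
  rw [card_shape_contents hρ, mul_assoc, coeff_X_pow_mul', compSum]
  by_cases hs : s ≤ n
  · rw [if_pos hs]
    by_cases hc : numOcc ρ ≤ r
    · rw [if_pos hc, ← coeff_mk_pow, ← coeff_C_mul, ← bgf_shape hρ, coeff_bgf, fiberCard]
      congr 1
      refine Nat.card_congr (Equiv.subtypeEquivRight fun D => ?_)
      refine and_congr ?_ ?_
      · omega
      · omega
    · rw [if_neg hc, mul_zero, map_zero, Nat.cast_eq_zero]
      have : IsEmpty {D : ∀ i, contents ρ i // s + ∑ i, mult ρ i * (D i).1.1 = n ∧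
          numOcc ρ + ∑ i, (if mate ρ i = i then numOcc (D i).1.2.1 else 0) = r} :=
        ⟨fun D => hc ((Nat.le_add_right _ _).trans_eq D.2.2)⟩
      exact Nat.card_of_isEmpty
  · rw [if_neg hs, Nat.cast_eq_zero]
    have : IsEmpty {D : ∀ i, contents ρ i // s + ∑ i, mult ρ i * (D i).1.1 = n ∧
        numOcc ρ + ∑ i, (if mate ρ i = i then numOcc (D i).1.2.1 else 0) = r} :=
      ⟨fun D => hs ((Nat.le_add_right _ _).trans_eq D.2.1)⟩
    exact Nat.card_of_isEmpty

end Shapes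

/-! ### Which shapes occur, and the sum over them -/

section Padding

/-- Fixed points can be appended to a shape. -/
theorem Shape.mem_K {s t : ℕ} {ρ : Equiv.Perm (Fin s)} (hρ : Shape ρ) (hst : s ≤ t) :
    (⟨s, ρ⟩ : Σ s, Equiv.Perm (Fin s)) ∈ K t := by
  have hρ' : ∀ x, ρ (ρ x) = x := hρ.inv.apply_apply
  let g : Fin t → Fin t := fun x => if h : x.1 < s then Fin.castLE hst (ρ ⟨x, h⟩) else x
  have hlt : ∀ k : Fin s, g (Fin.castLE hst k) = Fin.castLE hst (ρ k) := fun k => dif_pos k.2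
  have hge : ∀ x : Fin t, s ≤ x.1 → g x = x := fun x hx => dif_neg (not_lt.2 hx)
  have hcase : ∀ x : Fin t, x.1 < s → ∃ k : Fin s, Fin.castLE hst k = x := fun x hx =>
    ⟨⟨x, hx⟩, rfl⟩
  have hg : Function.Involutive g := by
    intro x
    rcases lt_or_ge x.1 s with hx | hx
    · obtain ⟨k, rfl⟩ := hcase x hx
      rw [hlt, hlt, hρ']
    · rw [hge x hx, hge x hx]
  let π : Equiv.Perm (Fin t) := hg.toPerm
  have hinv : IsInvolution π := isInvolution_iff.2 hg
  refine ⟨π, hinv, Fin.castLEOrderEmb hst,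
    (isKernel_iff hinv (hρ.pos.trans_le hst)).2 ⟨⟨?_, ?_, ?_, ?_⟩, hlt⟩⟩
  · exact ⟨_, ⟨⟨0, hρ.pos⟩, rfl⟩, fun x => Nat.zero_le _⟩
  · rintro _ ⟨k, rfl⟩
    exact ⟨ρ k, (hlt k).symm⟩
  · exact (conn_range_iff (Fin.castLEOrderEmb hst).strictMono hlt).2 hρ.conn
  · intro a b c d ho _
    obtain ⟨h1, h2, h3, -, h5, -⟩ := ho
    -- An appended fixed point exceeds all entries before it, so it cannot be the last entry of an
    -- occurrence.
    have hd : d.1 < s := by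
      by_contra h
      have hd : π d = d := hge d (not_lt.1 h)
      rw [hd] at h5
      rcases lt_or_ge a.1 s with ha | ha
      · obtain ⟨k, rfl⟩ := hcase a ha
        have h5 : d < g (Fin.castLE hst k) := h5
        rw [hlt] at h5
        exact h ((Fin.lt_def.1 h5).trans (ρ k).2)
      · have h5 : d < g a := h5
        rw [hge a ha] at h5
        exact lt_asymm h5 (h1.trans (h2.trans h3))
    have hmem : ∀ x, x ≤ d → x ∈ Set.range (Fin.castLEOrderEmb hst) := fun x hx =>
      hcase x ((Fin.le_def.1 hx).trans_lt hd)
    exact ⟨hmem a (h1.trans (h2.trans h3)).le, hmem b (h2.trans h3).le, hmem c h3.le, hmem d le_rfl⟩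

theorem IsKernel.size_le {s n : ℕ} {π : Equiv.Perm (Fin n)} {ρ : Equiv.Perm (Fin s)}
    {e : Fin s ↪o Fin n} (hinv : IsInvolution π) (hn : 0 < n) (h : IsKernel ρ π e) :
    s ≤ 2 * numOcc π + 2 := by
  have h1 := (kerSet_kernelSet hinv hn).2
  have h2 : (occIn π (kernelSet π)).ncard ≤ numOcc π := by
    rw [numOcc_eq_ncard]
    exact Set.ncard_le_ncard (fun q hq => ⟨hq.1, trivial, trivial, trivial, trivial⟩)
      (Set.toFinite _)
  rw [← h.1, ncard_range_emb] at h1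
  rw [← h.1] at h2
  omega

theorem IsKernel.mem_K {s n : ℕ} {π : Equiv.Perm (Fin n)} {ρ : Equiv.Perm (Fin s)}
    {e : Fin s ↪o Fin n} (hinv : IsInvolution π) (hn : 0 < n) (h : IsKernel ρ π e) :
    (⟨s, ρ⟩ : Σ s, Equiv.Perm (Fin s)) ∈ K (2 * numOcc π + 2) :=
  (h.shape hinv hn).mem_K (h.size_le hinv hn)

theorem shape_of_mem_K {t : ℕ} (ht : 0 < t) {ρ : Σ s, Equiv.Perm (Fin s)} (h : ρ ∈ K t) :
    Shape ρ.2 := by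
  obtain ⟨π, hinv, e, he⟩ := h
  exact he.shape hinv ht

theorem numOcc_zero (π : Equiv.Perm (Fin 0)) : numOcc π = 0 := by
  have : IsEmpty (Occ π) := ⟨fun o => (o.1 0).elim0⟩
  exact Nat.card_of_isEmpty

/-- Involutions with `r` occurrences of `3412`, sorted by kernel shape. -/
theorem card_eq_sum_shapes {r : ℕ} (hr : 1 ≤ r) (n : ℕ) :
    Nat.card {π : Equiv.Perm (Fin n) // IsInvolution π ∧ numOcc π = r} =
      ∑ ρ ∈ (K_finite (2 * r + 2)).toFinset, Nat.card {π : Equiv.Perm (Fin n) //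
        IsInvolution π ∧ (∃ e : Fin ρ.1 ↪o Fin n, IsKernel ρ.2 π e) ∧ numOcc π = r} := by
  have hex : ∀ π : {π : Equiv.Perm (Fin n) // IsInvolution π ∧ numOcc π = r},
      ∃ ρ : Σ s, Equiv.Perm (Fin s), (∃ e : Fin ρ.1 ↪o Fin n, IsKernel ρ.2 π.1 e) ∧
        ρ ∈ K (2 * r + 2) := by
    rintro ⟨π, hinv, hπ⟩
    -- The empty permutation has no kernel; it contains no occurrence, so `1 ≤ r` excludes it.
    have hn : 0 < n := by
      rcases Nat.eq_zero_or_pos n with rfl | h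
      · rw [numOcc_zero] at hπ
        omega
      · exact h
    obtain ⟨s, ρ, e, he⟩ := exists_isKernel hinv hn
    exact ⟨⟨s, ρ⟩, ⟨e, he⟩, hπ ▸ he.mem_K hinv hn⟩
  choose g hg hgK using hex
  rw [card_eq_sum_fiber g (K_finite (2 * r + 2)).toFinset fun π => (Set.Finite.mem_toFinset _).2 (hgK π)]
  refine Finset.sum_congr rfl fun ρ _ => Nat.card_congr
    { toFun := fun π => ⟨π.1.1, π.1.2.1, ?_, π.1.2.2⟩
      invFun := fun π => ⟨⟨π.1, π.2.1, π.2.2.2⟩, ?_⟩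
      left_inv := fun _ => rfl
      right_inv := fun _ => rfl }
  · obtain ⟨π, rfl⟩ := π
    exact hg π
  · obtain ⟨e, he⟩ := π.2.2.1
    obtain ⟨e', he'⟩ := hg ⟨π.1, π.2.1, π.2.2.2⟩
    exact he'.unique he

end Padding

end InvKernel

theorem theorem3p1 (r : ℕ) (hr : 1 ≤ r) :
    InvKernel.invGF r =
      ∑ ρ ∈ (InvKernel.K_finite (2 * r + 2)).toFinset,
        (PowerSeries.X ^ ρ.1 *
          ((1 - PowerSeries.X ^ 2) ^ InvKernel.d ρ.2 * (1 - PowerSeries.X) ^ InvKernel.dd ρ.2)⁻¹) *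
          InvKernel.compSum (InvKernel.f ρ.2) r (InvKernel.numOcc ρ.2) := by
  ext n
  rw [InvKernel.invGF, PowerSeries.coeff_mk, InvKernel.card_eq_sum_shapes hr, map_sum,
    Nat.cast_sum]
  refine Finset.sum_congr rfl fun ρ hρ => InvKernel.card_shape_eq_coeff ?_ n r
  exact InvKernel.shape_of_mem_K (by omega) ((Set.Finite.mem_toFinset _).1 hρ)
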